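/- **Language.** FOQ programs are generated by the following grammar, where $n\in\mathbb N$, $\mathrm x$ is an integer variable, $\bar{\mathrm q}$ a variable for lists of distinct qubit pointers ("sorted sets"), and $f$ ranges over total functions from $\mathbb Z$ to the reals of $[0,2\pi)$ that a Turing machine approximates within $2^{-k}$ in time polynomial in $k$: - integers $\mathrm i ::= n \mid \mathrm x\mid \mathrm i+n\mid \mathrm i-n\mid |\mathrm s|$; sorted sets $\mathrm s ::= \mathrm{nil}\mid\bar{\mathrm q}\mid \mathrm s\ominus[\mathrm i]$ (removal of the $\mathrm i$-th element; empty if $\mathrm i$ is out of range); Booleans $\mathrm b$ built from $>,\ge,=$ on integers with $\wedge,\vee,\neg$; qubits $\mathrm s[\mathrm i]$ ($0$ if out of range); - operators $\mathrm U ::= \mathrm{NOT}\mid R_Y^f(\mathrm i)\mid \mathrm{Ph}^f(\mathrm i)$, denoting $\begin{pmatrix}0&1\\1&0\end{pmatrix}$, the rotation matrix of angle $f(\mathrm i)$, and $\mathrm{diag}(1,e^{\sqrt{-1}f(\mathrm i)})$; - statements $\mathrm S ::= \mathbf{skip}\mid \mathrm s[\mathrm i]\mathrel{*}=\mathrm U\mid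 \mathrm S\,\mathrm S\mid \mathbf{if}\ \mathrm b\ \mathbf{then}\ \mathrm S\ \mathbf{else}\ \mathrm S\mid \mathbf{qcase}\ \mathrm s[\mathrm i]\ \mathbf{of}\ \{0\to \mathrm S,1\to \mathrm S\}\mid \mathbf{call}\ \mathrm{proc}[\mathrm i](\mathrm s)$; - programs $\mathrm P=\mathrm D::\mathrm S$, where $\mathrm D$ is a finite sequence of declarations $\mathbf{decl}\ \mathrm{proc}[\mathrm x](\bar{\mathrm p})\{\mathrm S^{\mathrm{proc}}\}$ (the integer parameter is optional). Programs are well-formed: $\mathrm S$ contains no variable but $\bar{\mathrm q}$, $\mathrm S^{\mathrm{proc}}$ contains no variables but its parameters, declared names are distinct, and calls are to declared procedures. The size $|\mathrm P|$ is the number of symbols of $\mathrm P$ (keywords, operators, identifiers and literals; brackets and separators need not be counted). A program runs on $n$ qubits with pointers $[1,\dots,n]$, all of them accessible; an assignment or quantum case on a qubit that is not accessible is an error; inside a quantum case the control qubit is not accessible; a call whose sorted set argument is empty does nothing. $\mathrm P$ is error-free if no unit state of any number $n\in\mathbb N$ of qubits leads to an error. **PFOQ.** Write $\mathrm{proc}\sim_{\mathrm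 P}\mathrm{proc}'$ if each of the two procedures reaches the other in the call graph (in zero or more steps). The width $w^{\mathrm{proc}}$ of a statement is $0$ for $\mathbf{skip}$ and assignments, additive on sequences, the maximum of the two branches for $\mathbf{if}$ and $\mathbf{qcase}$, and, for a call to $\mathrm{proc}'$, $1$ if $\mathrm{proc}\sim_{\mathrm P}\mathrm{proc}'$ and $0$ otherwise; the width of $\mathrm{proc}$ is $w^{\mathrm{proc}}(\mathrm S^{\mathrm{proc}})$. A well-formed program is in PFOQ if it is error-free, each call in $\mathrm S^{\mathrm{proc}}$ to a procedure $\mathrm{proc}'\sim_{\mathrm P}\mathrm{proc}$ has an argument of the form $\bar{\mathrm p}\ominus[\mathrm i_1,\dots,\mathrm i_k]$ with $k>0$, and all declared procedures have width at most $1$. **Algorithm.** A control structure $cs$ is a finite partial map from qubit pointers to $\{0,1\}$; $\cdot$ is the empty one. Expressions are evaluated with respect to a list $l$ of pointers and the value of $\mathrm x$. $\mathbf{compile}(\mathrm P,n)=\mathbf{compr}(\mathrm P,[1,\dots,n],\cdot)$, where $\mathbf{compr}(\mathrm D::\mathrm S,l,cs)$ returns: - the identity circuit for $\mathbf{skip}$;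 the operator controlled by $cs$ for an assignment; the composition of the compilations of $\mathrm S_1$ and $\mathrm S_2$ for $\mathrm S_1\,\mathrm S_2$; the compilation of the selected branch for an $\mathbf{if}$; the composition of the compilations of $\mathrm S_0$ and $\mathrm S_1$ under $cs[m:=0]$ and $cs[m:=1]$ for a quantum case on qubit $m$; - for a call $\mathrm{proc}[\mathrm i](\mathrm s)$ where $\mathrm s$ has value $l'$ and $\mathrm i$ has value $v$: the identity if $l'=[\,]$; else the compilation of $\mathrm S^{\mathrm{proc}}\{v/\mathrm x\}$ with respect to $l'$ and $cs$ if $\mathrm{proc}$ has width $0$, and the result of $\mathbf{optimize}$ on the queue $[(cs,\mathrm S^{\mathrm{proc}}\{v/\mathrm x\},l')]$ if it has width $1$. $\mathbf{optimize}$, for a procedure $\mathrm{proc}$, keeps circuits $C_L,C_R$ (initially the identity), a first-in-first-out queue of triples $(cs,\mathrm S,l)$, and an initially empty dictionary. It takes triples from the queue until it is empty, and returns $C_L\circ C_R$, where $\circ$ is composition with the left circuit performed first. - $\mathrm S=\mathrm S_1\,\mathrm S_2$: if $w^{\mathrm{proc}}(\mathrm S_1)=1$, enqueue $(cs,\mathrm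 S_1,l)$ and set $C_R$ to $\mathbf{compr}(\mathrm S_2)\circ C_R$; otherwise enqueue $(cs,\mathrm S_2,l)$ and set $C_L$ to $C_L\circ\mathbf{compr}(\mathrm S_1)$. - Conditional: if the selected branch has width $1$, enqueue it; otherwise append its compilation to $C_L$. - Quantum case on qubit $m$: if both branches have width $1$, enqueue both, with controls $cs[m:=0]$ and $cs[m:=1]$; otherwise enqueue a branch such that the other one has width $0$, and compose the compilation of that other branch before $C_R$, again with these controls. - Call to $\mathrm{proc}'$ with argument values $v$ and $l'\neq[\,]$ (nothing is done if $l'=[\,]$): if the key $(\mathrm{proc}',v,|l'|)$ is in the dictionary with value $(a,l'')$, take a fresh ancilla $e$, append $NOT(cs,e)\circ NOT(\cdot[e:=1],a)\circ SWAP(\cdot[e:=1],l',l'')$ to $C_L$, and compose the reversed circuit before $C_R$. If the key is absent, take a fresh ancilla $a$, store $(a,l')$ under the key, append $NOT(cs,a)$ to $C_L$, compose $NOT(cs,a)$ before $C_R$, and enqueue $(\cdot[a:=1],\mathrm S^{\mathrm{proc}'}\{v/\mathrm x\},l')$. **Cost.** Arithmetic operations and comparisons, the application of a function $f$, the dispatch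 on a statement, the composition of two circuits and the creation of an ancilla take unit time; lists, control structures and dictionaries are copied or scanned in time linear in their size; the computation of a width takes time quadratic in the size of the code. A gate is built in time equal to its size in elementary gates and wires, which is $O(k+1)$ for a one-qubit gate with $k$ control qubits and $O((k+1)|l_1|+1)$ for $SWAP(cs,l_1,l_2)$ with $|\mathrm{dom}(cs)|=k$, for some fixed constant $\kappa$ in these bounds. **Theorem.** Let $\mathrm P$ be a PFOQ program. Then $\mathbf{compile}(\mathrm P,n)$ terminates for every $n\in\mathbb N$ and runs in time $O(n^{2|\mathrm P|+1})$ as $n\to\infty$ (the implied constant may depend on $\mathrm P$ and $\kappa$). Moreover there is a polynomial $Q\in\mathbb N[X]$ such that, for every $n\in\mathbb N$, the circuit $\mathbf{compile}(\mathrm P,n)$ has size (number of gates and wires, ancillas included) at most $Q(n)$. -/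

import Mathlib

namespace FOQ

/-! ### Angles and basic operators -/

/-- Real numbers that a Turing machine approximates within `2 ^ (-k)`, for every `k` (given in
unary), in time polynomial in `k`. The machine outputs, in binary, the numerator `g k` of a dyadic
approximation `g k / 2 ^ k` of the absolute value; the sign is a single bit of information. -/
def PolyTimeReal (r : ℝ) : Prop :=
  ∃ g : ℕ → ℕ,
    Nonempty (Turing.TM2ComputableInPolyTime Computability.unaryEncodeNat
      Computability.encodeNat g) ∧
    ∀ k : ℕ, |(|r|) - (g k : ℝ) / 2 ^ k| ≤ 1 / 2 ^ k

/-- Total functions from the integers to the polynomial-time approximable reals of `[0, 2π)`. -/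
def AngleFun : Type :=
  {f : ℤ → ℝ // ∀ k, 0 ≤ f k ∧ f k < 2 * Real.pi ∧ PolyTimeReal (f k)}

/-! ### Syntax

A procedure has one integer parameter and one sorted set parameter, and the program statement has
one sorted set variable, so each syntactic category needs a single anonymous variable:
`IExp.x` is the integer variable and `SExp.q` is the sorted set variable. -/

mutual
/-- Integer expressions: `n`, `x`, `i + n`, `i - n`, `|s|`. -/
inductive IExp : Type
  | lit (n : ℕ) : IExp
  | x : IExp
  | plus (i : IExp) (n : ℕ) : IExp
  | minus (i : IExp) (n : ℕ) : IExp
  | size (s : SExp) : IExp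
/-- Sorted sets: `nil`, the variable, and `s ⊖ [i]`. -/
inductive SExp : Type
  | nil : SExp
  | q : SExp
  | rm (s : SExp) (i : IExp) : SExp
end

/-- Boolean expressions. -/
inductive BExp : Type
  | gt (i j : IExp) : BExp
  | ge (i j : IExp) : BExp
  | eq (i j : IExp) : BExp
  | and (a b : BExp) : BExp
  | or (a b : BExp) : BExp
  | not (a : BExp) : BExp

/-- Operators `NOT`, `R_Y^f(i)`, `Ph^f(i)`. -/
inductive Op : Type
  | not : Op
  | ry (f : AngleFun) (i : IExp) : Op
  | ph (f : AngleFun) (i : IExp) : Op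

/-- Procedure names. -/
abbrev ProcName : Type := ℕ

/-- Statements. A qubit is written as a pair `s`, `i`, for `s[i]`. The integer argument of a call
is optional. -/
inductive Stmt : Type
  | skip : Stmt
  | asg (s : SExp) (i : IExp) (U : Op) : Stmt
  | seq (S₁ S₂ : Stmt) : Stmt
  | ite (b : BExp) (St Sf : Stmt) : Stmt
  | qcase (s : SExp) (i : IExp) (S₀ S₁ : Stmt) : Stmt
  | call (p : ProcName) (i : Option IExp) (s : SExp) : Stmt

/-- A procedure declaration; `hasParam` tells whether there is an integer parameter. -/
structure Decl : Type where
  name : ProcName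
  hasParam : Bool
  body : Stmt

/-- Programs `D :: S`. -/
structure Program : Type where
  decls : List Decl
  main : Stmt

/-! ### Number of symbols

Keywords, operators, identifiers and literals count as one symbol each; brackets and separators are
not counted. -/

mutual
def IExp.symbols : IExp → ℕ
  | .lit _ => 1
  | .x => 1
  | .plus i _ => i.symbols + 2
  | .minus i _ => i.symbols + 2
  | .size s => s.symbols + 1
def SExp.symbols : SExp → ℕ
  | .nil => 1
  | .q => 1
  | .rm s i => s.symbols + i.symbols + 1
end

def BExp.symbols : BExp → ℕ
  | .gt i j => i.symbols + j.symbols + 1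
  | .ge i j => i.symbols + j.symbols + 1
  | .eq i j => i.symbols + j.symbols + 1
  | .and a b => a.symbols + b.symbols + 1
  | .or a b => a.symbols + b.symbols + 1
  | .not a => a.symbols + 1

def Op.symbols : Op → ℕ
  | .not => 1
  | .ry _ i => i.symbols + 2
  | .ph _ i => i.symbols + 2

def Stmt.symbols : Stmt → ℕ
  | .skip => 1
  | .asg s i U => s.symbols + i.symbols + U.symbols + 1
  | .seq S₁ S₂ => S₁.symbols + S₂.symbols
  | .ite b St Sf => b.symbols + St.symbols + Sf.symbols + 1
  | .qcase s i S₀ S₁ => s.symbols + i.symbols + S₀.symbols + S₁.symbols + 1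
  | .call _ none s => s.symbols + 2
  | .call _ (some i) s => i.symbols + s.symbols + 2

/-- The keyword `decl`, the name, the sorted set parameter, the integer parameter if any, and the
body. -/
def Decl.symbols (d : Decl) : ℕ :=
  3 + (if d.hasParam then 1 else 0) + d.body.symbols

def declsSymbols (D : List Decl) : ℕ := (D.map Decl.symbols).sum

/-- The size `|P|` of a program. -/
def Program.size (P : Program) : ℕ := declsSymbols P.decls + P.main.symbols

/-! ### Well-formed programs -/

mutual
def IExp.NoX : IExp → Prop
  | .lit _ => True
  | .x => False
  | .plus i _ => i.NoX
  | .minus i _ => i.NoX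
  | .size s => s.NoX
def SExp.NoX : SExp → Prop
  | .nil => True
  | .q => True
  | .rm s i => s.NoX ∧ i.NoX
end

def BExp.NoX : BExp → Prop
  | .gt i j => i.NoX ∧ j.NoX
  | .ge i j => i.NoX ∧ j.NoX
  | .eq i j => i.NoX ∧ j.NoX
  | .and a b => a.NoX ∧ b.NoX
  | .or a b => a.NoX ∧ b.NoX
  | .not a => a.NoX

def Op.NoX : Op → Prop
  | .not => True
  | .ry _ i => i.NoX
  | .ph _ i => i.NoX

/-- The integer variable does not occur in the statement. -/
def Stmt.NoX : Stmt → Prop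
  | .skip => True
  | .asg s i U => s.NoX ∧ i.NoX ∧ U.NoX
  | .seq S₁ S₂ => S₁.NoX ∧ S₂.NoX
  | .ite b St Sf => b.NoX ∧ St.NoX ∧ Sf.NoX
  | .qcase s i S₀ S₁ => s.NoX ∧ i.NoX ∧ S₀.NoX ∧ S₁.NoX
  | .call _ none s => s.NoX
  | .call _ (some i) s => i.NoX ∧ s.NoX

/-- The procedure calls that are substatements of a statement. -/
def Stmt.calls : Stmt → List (ProcName × Option IExp × SExp)
  | .skip => []
  | .asg _ _ _ => []
  | .seq S₁ S₂ => S₁.calls ++ S₂.calls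
  | .ite _ St Sf => St.calls ++ Sf.calls
  | .qcase _ _ S₀ S₁ => S₀.calls ++ S₁.calls
  | .call p i s => [(p, i, s)]

/-- Every call in `S` is to a declared procedure, with an integer argument exactly when the
procedure has an integer parameter. -/
def CallsDeclared (D : List Decl) (S : Stmt) : Prop :=
  ∀ c ∈ S.calls, ∃ d ∈ D, d.name = c.1 ∧ d.hasParam = c.2.1.isSome

def Program.WellFormed (P : Program) : Prop :=
  P.main.NoX ∧
  (∀ d ∈ P.decls, d.hasParam = false → d.body.NoX) ∧
  (P.decls.map Decl.name).Nodup ∧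
  CallsDeclared P.decls P.main ∧
  ∀ d ∈ P.decls, CallsDeclared P.decls d.body

/-! ### Semantics of expressions

Expressions are evaluated with respect to the value `x` of the integer variable and to the list `l`
of qubit pointers held by the sorted set variable. Keeping the value `x` apart replaces the
substitution of this value in the statement. -/

/-- The list without its `k`-th element (counted from `1`); empty if `k` is out of range. -/
def removeAt (v : List ℕ) (k : ℤ) : List ℕ :=
  if 1 ≤ k ∧ k ≤ (v.length : ℤ) then v.eraseIdx (k.toNat - 1) else []

/-- The `k`-th element of the list (counted from `1`); `0` if `k` is out of range. -/
def pointerAt (v : List ℕ) (k : ℤ) : ℕ :=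
  if 1 ≤ k ∧ k ≤ (v.length : ℤ) then v.getD (k.toNat - 1) 0 else 0

mutual
def IExp.eval (x : ℤ) (l : List ℕ) : IExp → ℤ
  | .lit n => n
  | .x => x
  | .plus i n => i.eval x l + n
  | .minus i n => i.eval x l - n
  | .size s => ((s.eval x l).length : ℤ)
def SExp.eval (x : ℤ) (l : List ℕ) : SExp → List ℕ
  | .nil => []
  | .q => l
  | .rm s i => removeAt (s.eval x l) (i.eval x l)
end

/-- The qubit index `s[i]`. -/
def qubitEval (x : ℤ) (l : List ℕ) (s : SExp) (i : IExp) : ℕ :=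
  pointerAt (s.eval x l) (i.eval x l)

def BExp.eval (x : ℤ) (l : List ℕ) : BExp → Bool
  | .gt i j => decide (i.eval x l > j.eval x l)
  | .ge i j => decide (i.eval x l ≥ j.eval x l)
  | .eq i j => decide (i.eval x l = j.eval x l)
  | .and a b => a.eval x l && b.eval x l
  | .or a b => a.eval x l || b.eval x l
  | .not a => !(a.eval x l)

/-- The unitary matrix denoted by an operator. -/
noncomputable def Op.eval (x : ℤ) (l : List ℕ) : Op → Matrix (Fin 2) (Fin 2) ℂ
  | .not => !![0, 1; 1, 0]
  | .ry f i =>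
      !![(Real.cos (f.1 (i.eval x l)) : ℂ), -(Real.sin (f.1 (i.eval x l)) : ℂ);
        (Real.sin (f.1 (i.eval x l)) : ℂ), (Real.cos (f.1 (i.eval x l)) : ℂ)]
  | .ph f i =>
      !![1, 0; 0, Complex.exp (Complex.I * (f.1 (i.eval x l) : ℂ))]

/-- The value of the optional integer argument of a call (`0` if there is none). -/
def argEval (x : ℤ) (l : List ℕ) : Option IExp → ℤ
  | none => 0
  | some i => i.eval x l

/-! ### Semantics of statements -/

/-- The Hilbert space of `n` qubits. The qubit with pointer `m + 1` is the coordinate `m`. -/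
abbrev QState (n : ℕ) : Type := EuclideanSpace ℂ (Fin n → Fin 2)

/-- The one-qubit matrix `M` applied to one qubit, tensored with the identity on the others. -/
noncomputable def applyAt {n : ℕ} (m : Fin n) (M : Matrix (Fin 2) (Fin 2) ℂ) (ψ : QState n) :
    QState n :=
  WithLp.toLp 2 fun w => ∑ b : Fin 2, M (w m) b * ψ (Function.update w m b)

/-- `∑ k, |k⟩⟨k| ψ k`, with the projections acting on one qubit. -/
noncomputable def merge {n : ℕ} (m : Fin n) (ψ : Fin 2 → QState n) : QState n :=
  WithLp.toLp 2 fun w => ψ (w m) w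

/-- Termination and error. -/
inductive Outcome : Type
  | top : Outcome
  | bot : Outcome

/-- Big-step semantics: `BigStep D S x ψ A l o ψ'` means that the statement `S`, run on the state
`ψ` with the set `A` of accessible qubits, the pointers `l` and the value `x` of the integer
variable, ends with outcome `o` in the state `ψ'`. -/
inductive BigStep (D : List Decl) {n : ℕ} :
    Stmt → ℤ → QState n → Set ℕ → List ℕ → Outcome → QState n → Prop
  | skip (x ψ A l) : BigStep D .skip x ψ A l .top ψ
  | asgBot (s i U x ψ A l) (h : qubitEval x l s i ∉ A) :
      BigStep D (.asg s i U) x ψ A l .bot ψ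
  | asgTop (s i U x ψ A l) (m : Fin n) (hm : qubitEval x l s i = m + 1) (h : (m : ℕ) + 1 ∈ A) :
      BigStep D (.asg s i U) x ψ A l .top (applyAt m (U.eval x l) ψ)
  | seq (S₁ S₂ x ψ ψ' ψ'' A l o) (h₁ : BigStep D S₁ x ψ A l .top ψ')
      (h₂ : BigStep D S₂ x ψ' A l o ψ'') : BigStep D (.seq S₁ S₂) x ψ A l o ψ''
  | seqBot (S₁ S₂ x ψ ψ' A l) (h₁ : BigStep D S₁ x ψ A l .bot ψ') :
      BigStep D (.seq S₁ S₂) x ψ A l .bot ψ'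
  | ite (b St Sf x ψ ψ' A l o)
      (h : BigStep D (bif b.eval x l then St else Sf) x ψ A l o ψ') :
      BigStep D (.ite b St Sf) x ψ A l o ψ'
  | caseTop (s i S₀ S₁ x ψ A l) (ψ' : Fin 2 → QState n) (m : Fin n)
      (hm : qubitEval x l s i = m + 1) (h : (m : ℕ) + 1 ∈ A)
      (h₀ : BigStep D S₀ x ψ (A \ {(m : ℕ) + 1}) l .top (ψ' 0))
      (h₁ : BigStep D S₁ x ψ (A \ {(m : ℕ) + 1}) l .top (ψ' 1)) :
      BigStep D (.qcase s i S₀ S₁) x ψ A l .top (merge m ψ')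
  | caseBot (s i S₀ S₁ x ψ A l) (ψ' : Fin 2 → QState n) (o₀ o₁ : Outcome)
      (h : qubitEval x l s i ∈ A)
      (h₀ : BigStep D S₀ x ψ (A \ {qubitEval x l s i}) l o₀ (ψ' 0))
      (h₁ : BigStep D S₁ x ψ (A \ {qubitEval x l s i}) l o₁ (ψ' 1))
      (ho : o₀ = .bot ∨ o₁ = .bot) :
      BigStep D (.qcase s i S₀ S₁) x ψ A l .bot ψ
  | caseNotin (s i S₀ S₁ x ψ A l) (h : qubitEval x l s i ∉ A) :
      BigStep D (.qcase s i S₀ S₁) x ψ A l .bot ψ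
  | call (p i s x ψ ψ' A l o) (d : Decl) (hd : d ∈ D) (hp : d.name = p)
      (hs : s.eval x l ≠ [])
      (h : BigStep D d.body (argEval x l i) ψ A (s.eval x l) o ψ') :
      BigStep D (.call p i s) x ψ A l o ψ'
  | callNil (p i s x ψ A l) (hs : s.eval x l = []) :
      BigStep D (.call p i s) x ψ A l .top ψ

/-- The pointers `[1, …, n]`. -/
def initPointers (n : ℕ) : List ℕ := List.range' 1 n

/-- No initial configuration evaluates to an error. -/
def Program.ErrorFree (P : Program) : Prop :=
  ∀ (n : ℕ) (ψ ψ' : QState n), ‖ψ‖ = 1 →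
    ¬ BigStep P.decls P.main 0 ψ (Set.Icc 1 n) (initPointers n) .bot ψ'

/-! ### The class PFOQ -/

/-- The body of `p₁` contains a call to `p₂`. -/
def Calls (D : List Decl) (p₁ p₂ : ProcName) : Prop :=
  ∃ d ∈ D, d.name = p₁ ∧ ∃ c ∈ d.body.calls, c.1 = p₂

/-- Mutual reachability in the call graph. -/
def Equivalent (D : List Decl) (p₁ p₂ : ProcName) : Prop :=
  Relation.ReflTransGen (Calls D) p₁ p₂ ∧ Relation.ReflTransGen (Calls D) p₂ p₁

/-- The expression is `p ⊖ [i₁, …, i_k]`, with `p` the variable and `k > 0`. -/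
def SExp.Shrinking : SExp → Prop
  | .nil => False
  | .q => False
  | .rm s _ => s = .q ∨ s.Shrinking

def Program.WF (P : Program) : Prop :=
  P.ErrorFree ∧
  ∀ d ∈ P.decls, ∀ c ∈ d.body.calls, Equivalent P.decls d.name c.1 → c.2.2.Shrinking

open Classical in
/-- The width of the procedure `p` relatively to a statement. -/
noncomputable def relWidth (D : List Decl) (p : ProcName) : Stmt → ℕ
  | .skip => 0
  | .asg _ _ _ => 0
  | .seq S₁ S₂ => relWidth D p S₁ + relWidth D p S₂
  | .ite _ St Sf => max (relWidth D p St) (relWidth D p Sf)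
  | .qcase _ _ S₀ S₁ => max (relWidth D p S₀) (relWidth D p S₁)
  | .call p' _ _ => if Equivalent D p p' then 1 else 0

/-- The width of a declared procedure. -/
noncomputable def Decl.width (D : List Decl) (d : Decl) : ℕ := relWidth D d.name d.body

/-- The set of (well-formed) PFOQ programs. -/
def PFOQ : Set Program :=
  {P | P.WellFormed ∧ P.WF ∧ ∀ d ∈ P.decls, d.width P.decls ≤ 1}

/-! ### Circuits -/

/-- Control structures: finite partial functions from qubit pointers to control values. -/
abbrev Ctrl : Type := Finmap fun _ : ℕ => Bool

/-- Gates acting on wires that are named by qubit pointers (ancillas included).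
* `unary M cs a` applies the matrix `M` to wire `a`, under the control `cs`;
* `cnot cs a` negates wire `a`, under the control `cs` (generalized Toffoli gate);
* `swap cs l₁ l₂` swaps the wires of `l₁` with those of `l₂`, under the control `cs`. -/
inductive Gate : Type
  | unary (M : Matrix (Fin 2) (Fin 2) ℂ) (cs : Ctrl) (a : ℕ) : Gate
  | cnot (cs : Ctrl) (a : ℕ) : Gate
  | swap (cs : Ctrl) (l₁ l₂ : List ℕ) : Gate

/-- Circuits, with wires tensored implicitly with identities; `comp C C'` performs `C` first. -/
inductive Circuit : Type
  | id : Circuit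
  | gate (g : Gate) : Circuit
  | comp (C C' : Circuit) : Circuit

/-- Elementary gates and auxiliary wires needed for a gate. A one-qubit gate with `k` controls is
built with `O(k)` elementary gates and ancillas and one controlled gate; a controlled swap of two
lists is built with one controlled swap gate for each pair of wires, and an ancilla. The number `κ`
is the constant of these constructions. -/
def Gate.size (κ : ℕ) : Gate → ℕ
  | .unary _ cs _ => κ * (cs.keys.card + 1) + 1
  | .cnot cs _ => κ * (cs.keys.card + 1) + 1
  | .swap cs l₁ _ => (κ * (cs.keys.card + 1) + 1) * l₁.length + 1

def Circuit.size (κ : ℕ) : Circuit → ℕ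
  | .id => 0
  | .gate g => g.size κ
  | .comp C C' => C.size κ + C'.size κ

/-! ### Running time of the evaluation of expressions

Arithmetic operations, comparisons and accesses to a memory cell take one time unit, and a list is
copied, measured or scanned in time equal to its length. -/

mutual
def IExp.time (x : ℤ) (l : List ℕ) : IExp → ℕ
  | .lit _ => 1
  | .x => 1
  | .plus i _ => i.time x l + 1
  | .minus i _ => i.time x l + 1
  | .size s => s.time x l + (s.eval x l).length + 1
def SExp.time (x : ℤ) (l : List ℕ) : SExp → ℕ
  | .nil => 1
  | .q => l.length + 1
  | .rm s i => s.time x l + i.time x l + (s.eval x l).length + 1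
end

def qubitTime (x : ℤ) (l : List ℕ) (s : SExp) (i : IExp) : ℕ :=
  s.time x l + i.time x l + (s.eval x l).length + 1

def BExp.time (x : ℤ) (l : List ℕ) : BExp → ℕ
  | .gt i j => i.time x l + j.time x l + 1
  | .ge i j => i.time x l + j.time x l + 1
  | .eq i j => i.time x l + j.time x l + 1
  | .and a b => a.time x l + b.time x l + 1
  | .or a b => a.time x l + b.time x l + 1
  | .not a => a.time x l + 1

/-- The application of the function `f` of an operator takes one time unit. -/
def Op.time (x : ℤ) (l : List ℕ) : Op → ℕ
  | .not => 1
  | .ry _ i => i.time x l + 1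
  | .ph _ i => i.time x l + 1

def argTime (x : ℤ) (l : List ℕ) : Option IExp → ℕ
  | none => 0
  | some i => i.time x l

/-- The computation of a width is quadratic in the size of the code. -/
def widthTime (D : List Decl) (S : Stmt) : ℕ := (declsSymbols D + S.symbols) ^ 2

/-! ### The compilation algorithm -/

/-- Global state of the algorithm: the next fresh ancilla index and the elapsed time. -/
structure Machine : Type where
  fresh : ℕ
  time : ℕ

/-- Computations of the algorithm; `none` stands for non-termination. -/
abbrev Comp (α : Type) : Type := StateT Machine Option α

/-- Spend `t` time units. -/
def tick (t : ℕ) : Comp Unit := modify fun st => { st with time := st.time + t }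

/-- A fresh ancilla, in one time unit. -/
def newAncilla : Comp ℕ := do
  tick 1
  let st ← get
  set { st with fresh := st.fresh + 1 }
  return st.fresh

/-- Build a gate; this takes as much time as the gate has elementary gates and wires. -/
def emit (κ : ℕ) (g : Gate) : Comp Circuit := do
  tick (g.size κ)
  return .gate g

/-- Compose two circuits, in one time unit. -/
def compose (C C' : Circuit) : Comp Circuit := do
  tick 1
  return .comp C C'

/-- The control structure `cs[a := b]`, computed by copying `cs`. -/
def setCtrl (cs : Ctrl) (a : ℕ) (b : Bool) : Comp Ctrl := do
  tick (cs.keys.card + 1)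
  return cs.insert a b

/-- Controlled statements, with the value `x` of the integer variable and the list `l` of pointers
with respect to which the statement is compiled. -/
structure CStmt : Type where
  cs : Ctrl
  stmt : Stmt
  x : ℤ
  l : List ℕ

/-- Dictionaries from triples (procedure, integer argument, size of the sorted set) to pairs
(ancilla, list of pointers). -/
abbrev Dict : Type := Finmap fun _ : ProcName × ℤ × ℕ => ℕ × List ℕ

/-- The declaration of a procedure, found by scanning the declarations. -/
def findDecl (D : List Decl) (p : ProcName) : Comp (Option Decl) := do
  tick (D.length + 1)
  return D.find? fun d => d.name = p

mutual
/-- `compr κ D S x l cs` compiles `D :: S` with respect to the pointers `l` and the control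
structure `cs`, `x` being the value of the integer variable. -/
noncomputable def compr (κ : ℕ) (D : List Decl) (S : Stmt) (x : ℤ) (l : List ℕ) (cs : Ctrl) :
    Comp Circuit := do
  tick 1
  match S with
  | .skip => return .id
  | .asg s i U =>
      tick (qubitTime x l s i + U.time x l)
      emit κ (.unary (U.eval x l) cs (qubitEval x l s i))
  | .seq S₁ S₂ =>
      let C₁ ← compr κ D S₁ x l cs
      let C₂ ← compr κ D S₂ x l cs
      compose C₁ C₂
  | .ite b St Sf =>
      tick (b.time x l)
      compr κ D (bif b.eval x l then St else Sf) x l cs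
  | .qcase s i S₀ S₁ =>
      tick (qubitTime x l s i)
      let cs₀ ← setCtrl cs (qubitEval x l s i) false
      let C₀ ← compr κ D S₀ x l cs₀
      let cs₁ ← setCtrl cs (qubitEval x l s i) true
      let C₁ ← compr κ D S₁ x l cs₁
      compose C₀ C₁
  | .call p i s =>
      tick (s.time x l)
      if s.eval x l = [] then
        return .id
      else
        tick (argTime x l i)
        match ← findDecl D p with
        | none => return .id
        | some d =>
            tick (widthTime D d.body + d.body.symbols)
            if d.width D = 0 then
              compr κ D d.body (argEval x l i) (s.eval x l) cs
            else if d.width D = 1 then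
              optimize κ D [⟨cs, d.body, argEval x l i, s.eval x l⟩] p ∅ .id .id
            else
              return .id
  partial_fixpoint
/-- `optimize κ D queue p anc CL CR` runs the loop of the optimization of the recursive procedure
`p`, where `queue` is the list of controlled statements that are left, `anc` is the current
dictionary, and `CL`, `CR` are the current left and right circuits. -/
noncomputable def optimize (κ : ℕ) (D : List Decl) (queue : List CStmt) (p : ProcName)
    (anc : Dict) (CL CR : Circuit) : Comp Circuit := do
  tick 1
  match queue with
  | [] => compose CL CR
  | ⟨cs, S, x, l⟩ :: rest =>
    match S with
    | .skip => optimize κ D rest p anc CL CR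
    | .asg _ _ _ => optimize κ D rest p anc CL CR
    | .seq S₁ S₂ =>
        tick (widthTime D S₁)
        if relWidth D p S₁ = 1 then
          let C ← compr κ D S₂ x l cs
          let CR' ← compose C CR
          optimize κ D (rest ++ [⟨cs, S₁, x, l⟩]) p anc CL CR'
        else
          let C ← compr κ D S₁ x l cs
          let CL' ← compose CL C
          optimize κ D (rest ++ [⟨cs, S₂, x, l⟩]) p anc CL' CR
    | .ite b St Sf =>
        tick (b.time x l)
        tick (widthTime D (bif b.eval x l then St else Sf))
        if relWidth D p (bif b.eval x l then St else Sf) = 1 then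
          optimize κ D (rest ++ [⟨cs, bif b.eval x l then St else Sf, x, l⟩]) p anc CL CR
        else
          let C ← compr κ D (bif b.eval x l then St else Sf) x l cs
          let CL' ← compose CL C
          optimize κ D rest p anc CL' CR
    | .qcase s i S₀ S₁ =>
        tick (qubitTime x l s i)
        tick (widthTime D S₀ + widthTime D S₁)
        let cs₀ ← setCtrl cs (qubitEval x l s i) false
        let cs₁ ← setCtrl cs (qubitEval x l s i) true
        if relWidth D p S₀ = 1 ∧ relWidth D p S₁ = 1 then
          optimize κ D (rest ++ [⟨cs₀, S₀, x, l⟩, ⟨cs₁, S₁, x, l⟩]) p anc CL CR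
        else if relWidth D p S₁ = 0 then
          let C ← compr κ D S₁ x l cs₁
          let CR' ← compose C CR
          optimize κ D (rest ++ [⟨cs₀, S₀, x, l⟩]) p anc CL CR'
        else if relWidth D p S₀ = 0 then
          let C ← compr κ D S₀ x l cs₀
          let CR' ← compose C CR
          optimize κ D (rest ++ [⟨cs₁, S₁, x, l⟩]) p anc CL CR'
        else
          optimize κ D rest p anc CL CR
    | .call p' i s =>
        tick (s.time x l)
        if s.eval x l = [] then
          optimize κ D rest p anc CL CR
        else
          tick (argTime x l i)
          tick ((s.eval x l).length + anc.keys.card + 1)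
          match anc.lookup (p', argEval x l i, (s.eval x l).length) with
          | some (a, l'') =>
              tick l''.length
              let e ← newAncilla
              let ctrl ← setCtrl ∅ e true
              let G₁ ← emit κ (.cnot cs e)
              let G₂ ← emit κ (.cnot ctrl a)
              let G₃ ← emit κ (.swap ctrl (s.eval x l) l'')
              let H₁ ← emit κ (.swap ctrl l'' (s.eval x l))
              let H₂ ← emit κ (.cnot ctrl a)
              let H₃ ← emit κ (.cnot cs e)
              let CL₁ ← compose CL G₁
              let CL₂ ← compose CL₁ G₂
              let CL₃ ← compose CL₂ G₃
              let CR₁ ← compose H₃ CR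
              let CR₂ ← compose H₂ CR₁
              let CR₃ ← compose H₁ CR₂
              optimize κ D rest p anc CL₃ CR₃
          | none =>
              let a ← newAncilla
              let ctrl ← setCtrl ∅ a true
              let G ← emit κ (.cnot cs a)
              let H ← emit κ (.cnot cs a)
              let CL' ← compose CL G
              let CR' ← compose H CR
              tick ((s.eval x l).length + 1)
              match ← findDecl D p' with
              | none =>
                  optimize κ D rest p
                    (anc.insert (p', argEval x l i, (s.eval x l).length) (a, s.eval x l)) CL' CR'
              | some d =>
                  tick d.body.symbols
                  optimize κ D (rest ++ [⟨ctrl, d.body, argEval x l i, s.eval x l⟩]) p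
                    (anc.insert (p', argEval x l i, (s.eval x l).length) (a, s.eval x l)) CL' CR'
  partial_fixpoint
end

/-- The outcome of a terminating run of the compiler: the circuit, its number of wires that are
inputs or ancillas created by the algorithm, and the running time. -/
structure Run : Type where
  circuit : Circuit
  wires : ℕ
  time : ℕ

/-- The size of the compiled circuit: its number of gates and wires. -/
def Run.size (κ : ℕ) (r : Run) : ℕ := r.circuit.size κ + r.wires

/-- The algorithm that compiles `P` for `n` input qubits. The wires `1, …, n` are the inputs, and
ancillas are numbered from `n + 1` on. The value is `none` if the algorithm does not terminate. -/
noncomputable def compile (κ : ℕ) (P : Program) (n : ℕ) : Option Run :=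
  ((compr κ P.decls P.main 0 (initPointers n) ∅).run ⟨n + 1, n⟩).map
    fun r => ⟨r.1, r.2.fresh - 1, r.2.time⟩

end FOQ

/-!
The procedures of a program are ordered by their rank in the call graph: a call stays in a class of
mutually recursive procedures or goes to a class of lower rank (`rank_lt_of_not_equivalent`). The
cost is bounded by induction on the rank (`ends_compr`).

Inside a class, the loop of the optimization compiles the body of a procedure once for each key
`(procedure, value, length)` of its dictionary (`ends_optimize`). A body of width `1` holds one
recursive call along each path, so every statement in the queue has width `1` and its other parts
only call procedures of lower rank. There are polynomially many keys: a recursive call shortens the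
list of pointers and changes the integer by at most the number `n` of qubits plus a constant, so the
value `|x| + (n + c) |l|`, the `potential`, never increases within the class, and the integers stay
in `O(n ^ 2)`. This gives `O(n ^ 3)` keys, and `O(n ^ 3)` for the cost of one step.

Control structures have a bounded number of keys, because a recursive call resets them to a single
ancilla, and quantum cases are nested only within a body or along calls that lower the rank. Thus
every rank multiplies the cost by `O(n ^ 3)`, and a program with `r` declarations is compiled in time
`O(n ^ (3 r + 3))` (`polyLE_callBudget`). A declaration has at least four symbols, so that the
exponent is at most `2 |P| + 1`. The size of the circuit is bounded by the time, since every gate and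
every ancilla is paid for when it is created (`Charged`).
-/

namespace FOQ

/-! ### Sizes and values of expressions -/

/-- The sum of the literals that can increase the absolute value of an integer expression. -/
def IExp.lits : IExp → ℕ
  | .lit n => n
  | .x => 0
  | .plus i n => i.lits + n
  | .minus i n => i.lits + n
  | .size _ => 0

/-- The sum of the literals of the optional integer argument of a call. -/
def argLits : Option IExp → ℕ
  | none => 0
  | some i => i.lits

theorem Stmt.one_le_symbols (S : Stmt) : 1 ≤ S.symbols := by
  induction S with
  | call p i s => cases i <;> simp [Stmt.symbols]
  | _ => simp [Stmt.symbols] <;> omega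

theorem length_removeAt (v : List ℕ) (k : ℤ) : (removeAt v k).length ≤ v.length - 1 := by
  unfold removeAt
  split_ifs with h
  · rw [List.length_eraseIdx]
    split_ifs <;> omega
  · simp

theorem length_sexp_eval (x : ℤ) (l : List ℕ) : ∀ s : SExp, (s.eval x l).length ≤ l.length
  | .nil => by simp [SExp.eval]
  | .q => by simp [SExp.eval]
  | .rm s i => by
      have := length_sexp_eval x l s
      have := length_removeAt (s.eval x l) (i.eval x l)
      simp only [SExp.eval]
      omega

/-- The argument of a recursive call is empty or strictly shorter than the list of pointers. -/
theorem SExp.Shrinking.length_eval_le (x : ℤ) (l : List ℕ) :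
    ∀ {s : SExp}, s.Shrinking → (s.eval x l).length ≤ l.length - 1
  | .nil, h => h.elim
  | .q, h => h.elim
  | .rm s i, h => by
      have := length_removeAt (s.eval x l) (i.eval x l)
      have := length_sexp_eval x l s
      simp only [SExp.eval]
      omega

theorem natAbs_iexp_eval_le (x : ℤ) (l : List ℕ) :
    ∀ i : IExp, (i.eval x l).natAbs ≤ x.natAbs + l.length + i.lits
  | .lit n => by simp [IExp.eval, IExp.lits]
  | .x => by simp [IExp.eval, IExp.lits]
  | .plus i n => by
      have := natAbs_iexp_eval_le x l i
      simp only [IExp.eval, IExp.lits]; omega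
  | .minus i n => by
      have := natAbs_iexp_eval_le x l i
      simp only [IExp.eval, IExp.lits]; omega
  | .size s => by
      have := length_sexp_eval x l s
      simp only [IExp.eval, IExp.lits]; omega

theorem natAbs_argEval_le (x : ℤ) (l : List ℕ) (i : Option IExp) :
    (argEval x l i).natAbs ≤ x.natAbs + l.length + argLits i := by
  cases i with
  | none => simp [argEval]
  | some i => exact natAbs_iexp_eval_le x l i

/-! ### Running time of the evaluation of expressions -/

section

variable {x : ℤ} {l : List ℕ} {n : ℕ}

mutual
theorem IExp.time_le (hl : l.length ≤ n) : ∀ i : IExp, i.time x l ≤ i.symbols * (n + 1)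
  | .lit _ => by simp [IExp.time, IExp.symbols]
  | .x => by simp [IExp.time, IExp.symbols]
  | .plus i _ => by
      have := IExp.time_le hl i
      simp only [IExp.time, IExp.symbols, Nat.add_mul]; omega
  | .minus i _ => by
      have := IExp.time_le hl i
      simp only [IExp.time, IExp.symbols, Nat.add_mul]; omega
  | .size s => by
      have := SExp.time_le hl s
      have := length_sexp_eval x l s
      simp only [IExp.time, IExp.symbols, Nat.add_mul]; omega
theorem SExp.time_le (hl : l.length ≤ n) : ∀ s : SExp, s.time x l ≤ s.symbols * (n + 1)
  | .nil => by simp [SExp.time, SExp.symbols]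
  | .q => by simp [SExp.time, SExp.symbols]; omega
  | .rm s i => by
      have := SExp.time_le hl s
      have := IExp.time_le hl i
      have := length_sexp_eval x l s
      simp only [SExp.time, SExp.symbols, Nat.add_mul]; omega
end

theorem qubitTime_le (hl : l.length ≤ n) (s : SExp) (i : IExp) :
    qubitTime x l s i ≤ (s.symbols + i.symbols + 1) * (n + 1) := by
  have := SExp.time_le (x := x) hl s
  have := IExp.time_le (x := x) hl i
  have := length_sexp_eval x l s
  simp only [qubitTime, Nat.add_mul]; omega

theorem BExp.time_le (hl : l.length ≤ n) (b : BExp) : b.time x l ≤ b.symbols * (n + 1) := by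
  induction b with
  | gt i j | ge i j | eq i j =>
      have := IExp.time_le (x := x) hl i
      have := IExp.time_le (x := x) hl j
      simp only [BExp.time, BExp.symbols, Nat.add_mul]; omega
  | and a b iha ihb | or a b iha ihb =>
      simp only [BExp.time, BExp.symbols, Nat.add_mul]; omega
  | not a ih => simp only [BExp.time, BExp.symbols, Nat.add_mul]; omega

theorem Op.time_le (hl : l.length ≤ n) (U : Op) : U.time x l ≤ U.symbols * (n + 1) := by
  cases U with
  | not => simp [Op.time, Op.symbols]
  | ry f i | ph f i =>
      have := IExp.time_le (x := x) hl i
      simp only [Op.time, Op.symbols, Nat.add_mul]; omega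

theorem callTime_le (hl : l.length ≤ n) (p : ProcName) (i : Option IExp) (s : SExp) :
    s.time x l + argTime x l i ≤ (Stmt.call p i s).symbols * (n + 1) := by
  have := SExp.time_le (x := x) hl s
  cases i with
  | none => simp only [argTime, Stmt.symbols, Nat.add_mul]; omega
  | some i =>
      have := IExp.time_le (x := x) hl i
      simp only [argTime, Stmt.symbols, Nat.add_mul]; omega

end

/-! ### Terminating computations and their cost -/

/-- The computation `c`, started in the machine state `m`, terminates with a value and a machine
state that satisfy `Q`. -/
def Ends {α : Type} (c : Comp α) (m : Machine) (Q : α → Machine → Prop) : Prop :=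
  ∃ a m', c m = some (a, m') ∧ Q a m'

theorem Ends.mono {α : Type} {c : Comp α} {m : Machine} {Q Q' : α → Machine → Prop}
    (h : Ends c m Q) (hQ : ∀ a m', Q a m' → Q' a m') : Ends c m Q' := by
  obtain ⟨a, m', e, q⟩ := h
  exact ⟨a, m', e, hQ a m' q⟩

@[simp]
theorem ends_bind {α β : Type} (c : Comp α) (f : α → Comp β) (m : Machine)
    (Q : β → Machine → Prop) :
    Ends (c >>= f) m Q ↔ Ends c m fun a m' => Ends (f a) m' Q := by
  constructor
  · rintro ⟨b, m', e, q⟩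
    change (c m).bind (fun r => f r.1 r.2) = _ at e
    obtain ⟨⟨a, m₁⟩, h₁, h₂⟩ := Option.bind_eq_some_iff.1 e
    exact ⟨a, m₁, h₁, b, m', h₂, q⟩
  · rintro ⟨a, m₁, h₁, b, m', h₂, q⟩
    refine ⟨b, m', ?_, q⟩
    change (c m).bind (fun r => f r.1 r.2) = _
    rw [h₁]
    exact h₂

/-- A computation that always succeeds is described by its result. -/
theorem ends_of_eq {α : Type} {c : Comp α} {m m' : Machine} {a : α} (h : c m = some (a, m'))
    (Q : α → Machine → Prop) : Ends c m Q ↔ Q a m' := by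
  constructor
  · rintro ⟨b, m₁, e, q⟩
    rw [h] at e
    obtain ⟨rfl, rfl⟩ := Prod.mk.inj (Option.some.inj e)
    exact q
  · exact fun q => ⟨a, m', h, q⟩

section

variable (m : Machine)

@[simp]
theorem ends_pure {α : Type} (a : α) (Q : α → Machine → Prop) :
    Ends (pure a : Comp α) m Q ↔ Q a m := ends_of_eq rfl Q

@[simp]
theorem ends_tick (t : ℕ) (Q : Unit → Machine → Prop) :
    Ends (tick t) m Q ↔ Q () ⟨m.fresh, m.time + t⟩ := ends_of_eq rfl Q

@[simp]
theorem ends_newAncilla (Q : ℕ → Machine → Prop) :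
    Ends newAncilla m Q ↔ Q m.fresh ⟨m.fresh + 1, m.time + 1⟩ := ends_of_eq rfl Q

@[simp]
theorem ends_emit (κ : ℕ) (g : Gate) (Q : Circuit → Machine → Prop) :
    Ends (emit κ g) m Q ↔ Q (.gate g) ⟨m.fresh, m.time + g.size κ⟩ := ends_of_eq rfl Q

@[simp]
theorem ends_compose (C C' : Circuit) (Q : Circuit → Machine → Prop) :
    Ends (compose C C') m Q ↔ Q (.comp C C') ⟨m.fresh, m.time + 1⟩ := ends_of_eq rfl Q

@[simp]
theorem ends_setCtrl (cs : Ctrl) (a : ℕ) (b : Bool) (Q : Ctrl → Machine → Prop) :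
    Ends (setCtrl cs a b) m Q ↔ Q (cs.insert a b) ⟨m.fresh, m.time + (cs.keys.card + 1)⟩ :=
  ends_of_eq rfl Q

@[simp]
theorem ends_findDecl (D : List Decl) (p : ProcName) (Q : Option Decl → Machine → Prop) :
    Ends (findDecl D p) m Q ↔
      Q (D.find? fun d => d.name = p) ⟨m.fresh, m.time + (D.length + 1)⟩ := ends_of_eq rfl Q

end

/-- The computation of a circuit `C` from the state `m` to the state `m'` takes at most `t` time
units. The time also pays for the ancillas and for the gates of `C` that are not among the `base`
elementary gates and wires which were built before. -/
def Charged (κ : ℕ) (m : Machine) (base t : ℕ) (C : Circuit) (m' : Machine) : Prop :=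
  m'.time ≤ m.time + t ∧ C.size κ + m'.fresh + m.time ≤ base + m.fresh + m'.time

/-- A computation may be charged to an earlier machine state, if the time spent since then pays for
what was built since then. -/
theorem Charged.weaken {κ : ℕ} {m m' m'' : Machine} {base base' t t' : ℕ} {C : Circuit}
    (h : Charged κ m' base' t' C m'') (htime : m'.time + t' ≤ m.time + t)
    (hbase : base' + m'.fresh + m.time ≤ base + m.fresh + m'.time) :
    Charged κ m base t C m'' := by
  obtain ⟨h₁, h₂⟩ := h
  constructor <;> omega

/-! ### Keys of control structures and dictionaries -/

theorem keys_insert {α : Type} {β : α → Type} [DecidableEq α] (f : Finmap β) (a : α) (b : β a) :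
    (f.insert a b).keys = insert a f.keys := by
  ext c
  simp [Finmap.mem_keys, Finmap.mem_insert]

theorem card_keys_insert_le {α : Type} {β : α → Type} [DecidableEq α] (f : Finmap β) (a : α)
    (b : β a) : (f.insert a b).keys.card ≤ f.keys.card + 1 := by
  rw [keys_insert]
  exact Finset.card_insert_le _ _

/-! ### The call graph -/

/-- The number of declared procedures that can be reached from `p` but that do not reach `p`. It is
constant on the classes of mutually recursive procedures, and it decreases along the other calls. -/
noncomputable def rank (D : List Decl) (p : ProcName) : ℕ :=
  open Classical in
  ((D.map Decl.name).toFinset.filter fun q =>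
    Relation.ReflTransGen (Calls D) p q ∧ ¬ Relation.ReflTransGen (Calls D) q p).card

section

variable {D : List Decl} {p q r : ProcName}

theorem Equivalent.refl (p : ProcName) : Equivalent D p p := ⟨.refl, .refl⟩

theorem Equivalent.symm (h : Equivalent D p q) : Equivalent D q p := ⟨h.2, h.1⟩

theorem Equivalent.trans (h : Equivalent D p q) (h' : Equivalent D q r) : Equivalent D p r :=
  ⟨h.1.trans h'.1, h'.2.trans h.2⟩

theorem Equivalent.rank_eq (h : Equivalent D p q) : rank D p = rank D q := by
  classical
  unfold rank
  congr 1
  refine Finset.filter_congr fun r _ => ?_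
  exact ⟨fun hr => ⟨h.2.trans hr.1, fun hn => hr.2 (hn.trans h.2)⟩,
    fun hr => ⟨h.1.trans hr.1, fun hn => hr.2 (hn.trans h.1)⟩⟩

theorem rank_lt_of_not_equivalent (h : Calls D p q) (hq : ∃ d ∈ D, d.name = q)
    (hn : ¬ Equivalent D p q) : rank D q < rank D p := by
  classical
  have hpq : Relation.ReflTransGen (Calls D) p q := .single h
  have hqp : ¬ Relation.ReflTransGen (Calls D) q p := fun h' => hn ⟨hpq, h'⟩
  refine Finset.card_lt_card (Finset.ssubset_iff_of_subset ?_ |>.2 ⟨q, ?_, ?_⟩)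
  · intro r hr
    rw [Finset.mem_filter] at hr ⊢
    exact ⟨hr.1, hpq.trans hr.2.1, fun h' => hr.2.2 (h'.trans hpq)⟩
  · obtain ⟨d, hd, rfl⟩ := hq
    rw [Finset.mem_filter, List.mem_toFinset]
    exact ⟨List.mem_map_of_mem hd, hpq, hqp⟩
  · simp [Relation.ReflTransGen.refl]

theorem rank_lt_length (hp : ∃ d ∈ D, d.name = p) : rank D p < D.length := by
  classical
  obtain ⟨d, hd, rfl⟩ := hp
  refine lt_of_lt_of_le (Finset.card_lt_card (Finset.filter_ssubset.2
    ⟨d.name, List.mem_toFinset.2 (List.mem_map_of_mem hd), ?_⟩)) ?_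
  · simp [Relation.ReflTransGen.refl]
  · exact (List.toFinset_card_le _).trans (by simp)

/-! ### Widths -/

theorem Equivalent.relWidth_eq (h : Equivalent D p q) (S : Stmt) :
    relWidth D p S = relWidth D q S := by
  induction S with
  | skip | asg => rfl
  | seq S₁ S₂ ih₁ ih₂ => simp only [relWidth, ih₁, ih₂]
  | ite b S₁ S₂ ih₁ ih₂ => simp only [relWidth, ih₁, ih₂]
  | qcase s i S₁ S₂ ih₁ ih₂ => simp only [relWidth, ih₁, ih₂]
  | call r i s =>
      have : Equivalent D p r ↔ Equivalent D q r := ⟨h.symm.trans, h.trans⟩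
      classical exact if_congr this rfl rfl

theorem relWidth_eq_zero_iff {S : Stmt} :
    relWidth D p S = 0 ↔ ∀ c ∈ S.calls, ¬ Equivalent D p c.1 := by
  induction S with
  | skip | asg => simp [relWidth, Stmt.calls]
  | seq S₁ S₂ ih₁ ih₂ | ite b S₁ S₂ ih₁ ih₂ | qcase s i S₁ S₂ ih₁ ih₂ =>
      simp only [relWidth, Stmt.calls, List.forall_mem_append, ← ih₁, ← ih₂]
      omega
  | call r i s => simp [relWidth, Stmt.calls]

/-- A procedure that is equivalent to a recursive procedure is recursive itself. -/
theorem relWidth_body_ne_zero {d e : Decl} (hnd : (D.map Decl.name).Nodup) (hd : d ∈ D)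
    (he : e ∈ D) (h : Equivalent D d.name e.name) (hw : relWidth D d.name d.body ≠ 0) :
    relWidth D d.name e.body ≠ 0 := by
  rw [Ne, relWidth_eq_zero_iff]
  intro hno
  rcases h.2.cases_head with heq | ⟨r, ⟨d', hd', hname, c, hc, rfl⟩, hr⟩
  · obtain rfl := List.inj_on_of_nodup_map hnd hd he heq.symm
    exact hw (relWidth_eq_zero_iff.2 hno)
  · obtain rfl := List.inj_on_of_nodup_map hnd hd' he hname
    exact hno c hc ⟨h.1.trans (.single ⟨d', hd', rfl, c, hc, rfl⟩), hr⟩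

end

theorem find_decl {D : List Decl} {p : ProcName} (h : ∃ d ∈ D, d.name = p) :
    ∃ d ∈ D, d.name = p ∧ D.find? (fun d => d.name = p) = some d := by
  cases hf : D.find? fun d => d.name = p with
  | none =>
      obtain ⟨d, hd, hp⟩ := h
      simpa [hp] using List.find?_eq_none.1 hf d hd
  | some d =>
      exact ⟨d, List.mem_of_find?_eq_some hf, by simpa using List.find?_some hf, rfl⟩

/-! ### Parameters of the cost analysis -/

/-- Bounds for the quantities that determine the cost of one step of the algorithm. -/
structure Bounds : Type where
  /-- the constant in the size of gates -/
  κ : ℕ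
  /-- the declarations of the program -/
  D : List Decl
  /-- bound for the number of pointers -/
  n : ℕ
  /-- bound for the number of symbols of statements -/
  s : ℕ
  /-- bound for the literals in integer arguments of calls -/
  c : ℕ
  /-- bound for the number of keys of control structures -/
  K : ℕ
  /-- bound for the absolute value of integer arguments -/
  X : ℕ

namespace Bounds

variable (B : Bounds)

/-- The triples that may occur as keys of dictionaries. -/
noncomputable def keys : Finset (ProcName × ℤ × ℕ) :=
  (B.D.map Decl.name).toFinset ×ˢ (Finset.Icc (-(B.X : ℤ)) B.X ×ˢ Finset.range (B.n + 1))

/-- A bound for the size of a one-qubit gate with at most `B.K` controls. -/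
def gate : ℕ := B.κ * (B.K + 1) + 1

/-- A bound for the cost of one step of the algorithm, compilations of statements by recursive
calls excluded. -/
noncomputable def step : ℕ :=
  30 + 2 * B.s + (B.s + 1) * (B.n + 1) + 2 * (declsSymbols B.D + B.s) ^ 2 + 2 * B.K + 5 * B.n +
    B.keys.card + 4 * B.gate + 2 * (B.gate * B.n) + 2 * B.D.length

variable {B}

theorem widthTime_le {S : Stmt} (h : S.symbols ≤ B.s) :
    widthTime B.D S ≤ (declsSymbols B.D + B.s) ^ 2 :=
  Nat.pow_le_pow_left (by omega) 2

theorem control_le {cs : Ctrl} (h : cs.keys.card ≤ B.K) :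
    B.κ * (cs.keys.card + 1) + 1 ≤ B.gate :=
  Nat.add_le_add_right (Nat.mul_le_mul_left _ (by omega)) 1

theorem unary_size_le {M : Matrix (Fin 2) (Fin 2) ℂ} {cs : Ctrl} {a : ℕ}
    (h : cs.keys.card ≤ B.K) : (Gate.unary M cs a).size B.κ ≤ B.gate := control_le h

theorem cnot_size_le {cs : Ctrl} {a : ℕ} (h : cs.keys.card ≤ B.K) :
    (Gate.cnot cs a).size B.κ ≤ B.gate := control_le h

theorem swap_size_le {cs : Ctrl} {l₁ l₂ : List ℕ} (h : cs.keys.card ≤ B.K)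
    (hl : l₁.length ≤ B.n) : (Gate.swap cs l₁ l₂).size B.κ ≤ B.gate * B.n + 1 :=
  Nat.add_le_add_right (Nat.mul_le_mul (control_le h) hl) 1

/-- Expressions with at most `B.s` symbols, with a unit to spare, are evaluated in this time. -/
theorem mul_le_step {k : ℕ} (h : k ≤ B.s + 1) : k * (B.n + 1) ≤ (B.s + 1) * (B.n + 1) :=
  Nat.mul_le_mul_right _ h

end Bounds

/-! ### The loop of the optimization -/

/-- The call `c` is to a declared procedure, with small literals; either this procedure is equivalent
to `p` and the argument shrinks, or it has lower rank than `p`. -/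
def GoodCall (B : Bounds) (p : ProcName) (c : ProcName × Option IExp × SExp) : Prop :=
  (∃ d ∈ B.D, d.name = c.1) ∧ argLits c.2.1 ≤ B.c ∧ (Equivalent B.D p c.1 → c.2.2.Shrinking) ∧
    (¬ Equivalent B.D p c.1 → rank B.D c.1 < rank B.D p)

/-- The call `c` is to a declared procedure of rank less than `h`, with small literals. -/
def LowCall (B : Bounds) (h : ℕ) (c : ProcName × Option IExp × SExp) : Prop :=
  (∃ d ∈ B.D, d.name = c.1) ∧ argLits c.2.1 ≤ B.c ∧ rank B.D c.1 < h

/-- A potential that bounds the value of the integer variable. It does not increase along calls with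
a shrinking argument: they shorten the list `l`, and increase the absolute value of the variable by
`B.n + B.c` at most. -/
def potential (B : Bounds) (x : ℤ) (l : List ℕ) : ℕ := x.natAbs + (B.n + B.c) * l.length

theorem natAbs_le_potential (B : Bounds) (x : ℤ) (l : List ℕ) : x.natAbs ≤ potential B x l :=
  Nat.le_add_right _ _

theorem potential_call_le {B : Bounds} {x : ℤ} {l : List ℕ} {i : Option IExp} {s : SExp}
    (hl : l.length ≤ B.n) (hi : argLits i ≤ B.c) :
    potential B (argEval x l i) (s.eval x l) ≤ potential B x l + (B.n + B.c) := by
  have h₁ := natAbs_argEval_le x l i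
  have h₂ := Nat.mul_le_mul_left (B.n + B.c) (length_sexp_eval x l s)
  unfold potential
  omega

theorem potential_shrinking_call_le {B : Bounds} {x : ℤ} {l : List ℕ} {i : Option IExp} {s : SExp}
    (hl : l.length ≤ B.n) (hi : argLits i ≤ B.c) (hs : s.Shrinking) (hne : s.eval x l ≠ []) :
    potential B (argEval x l i) (s.eval x l) ≤ potential B x l := by
  have h₁ := natAbs_argEval_le x l i
  have h₃ := hs.length_eval_le x l
  have h₄ := List.length_pos_iff.2 hne
  have h₂ : (B.n + B.c) * ((s.eval x l).length + 1) ≤ (B.n + B.c) * l.length :=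
    Nat.mul_le_mul_left _ (by omega)
  rw [Nat.mul_succ] at h₂
  unfold potential
  omega

/-- The conditions on a statement under the control `cs`, with the value `x` of the integer variable
and the pointers `l`, which make its compilation cheap. The numbers `M` and `k` bound the
potential and the number of controls that the statement leads to. -/
structure Fits (B : Bounds) (M k : ℕ) (S : Stmt) (x : ℤ) (l : List ℕ) (cs : Ctrl) : Prop where
  length : l.length ≤ B.n
  potential : potential B x l ≤ M
  ctrl : cs.keys.card + S.symbols ≤ k
  symbols : S.symbols ≤ B.s

theorem Fits.sub {B : Bounds} {M k : ℕ} {S S' : Stmt} {x : ℤ} {l : List ℕ} {cs : Ctrl}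
    (h : Fits B M k S x l cs) (hS : S'.symbols ≤ S.symbols) : Fits B M k S' x l cs :=
  ⟨h.length, h.potential, by have := h.ctrl; omega, hS.trans h.symbols⟩

theorem Fits.insert {B : Bounds} {M k : ℕ} {S S' : Stmt} {x : ℤ} {l : List ℕ} {cs : Ctrl}
    (h : Fits B M k S x l cs) (hS : S'.symbols < S.symbols) (a : ℕ) (b : Bool) :
    Fits B M k S' x l (cs.insert a b) :=
  ⟨h.length, h.potential, by
    have := h.ctrl
    have := card_keys_insert_le cs a b
    omega, hS.le.trans h.symbols⟩

/-- The conditions on the elements of the queue in the optimization of `p`. -/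
structure GoodItem (B : Bounds) (p : ProcName) (M k : ℕ) (q : CStmt) : Prop where
  fits : Fits B M k q.stmt q.x q.l q.cs
  width : relWidth B.D p q.stmt = 1
  calls : ∀ c ∈ q.stmt.calls, GoodCall B p c

theorem lowCall_of_relWidth_eq_zero {B : Bounds} {p : ProcName} {S : Stmt}
    (hw : relWidth B.D p S = 0) (h : ∀ c ∈ S.calls, GoodCall B p c) :
    ∀ c ∈ S.calls, LowCall B (rank B.D p) c := fun c hc =>
  ⟨(h c hc).1, (h c hc).2.1, (h c hc).2.2.2 (relWidth_eq_zero_iff.1 hw c hc)⟩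

theorem mem_keys_of_potential {B : Bounds} {q : ProcName} {x : ℤ} {l : List ℕ}
    (hq : ∃ d ∈ B.D, d.name = q) (hx : potential B x l ≤ B.X) (hl : l.length ≤ B.n) :
    (q, x, l.length) ∈ B.keys := by
  obtain ⟨d, hd, rfl⟩ := hq
  have := natAbs_le_potential B x l
  simp only [Bounds.keys, Finset.mem_product, Finset.mem_Icc, Finset.mem_range, List.mem_toFinset]
  exact ⟨List.mem_map_of_mem hd, by omega, by omega⟩

/-- The loop of the optimization terminates, and each step costs at most `B.step + T`, where `T` bounds
the compilation of a statement without recursive calls. The number `w` bounds the number of steps: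
a step either shortens the code in the queue, or puts a new key in the dictionary, which may happen
once per element of `B.keys` and adds a body of at most `B.s` symbols to the queue. -/
theorem ends_optimize {B : Bounds} {p : ProcName} {M k T : ℕ} (hM : M ≤ B.X) (hk : k ≤ B.K)
    (hks : B.s + 1 ≤ k)
    (hcompr : ∀ S x l cs, (∀ c ∈ S.calls, LowCall B (rank B.D p) c) → Fits B M k S x l cs →
      ∀ m, Ends (compr B.κ B.D S x l cs) m (Charged B.κ m 0 T))
    (hbody : ∀ d ∈ B.D, Equivalent B.D p d.name → d.body.symbols ≤ B.s ∧
      relWidth B.D p d.body = 1 ∧ ∀ c ∈ d.body.calls, GoodCall B p c)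
    (w : ℕ) (queue : List CStmt) (anc : Dict) (CL CR : Circuit) (m : Machine)
    (hqueue : ∀ q ∈ queue, GoodItem B p M k q) (hanc : anc.keys ⊆ B.keys)
    (hlen : ∀ key a l, anc.lookup key = some (a, l) → l.length ≤ B.n)
    (hw : (queue.map fun q => q.stmt.symbols).sum + (B.keys.card - anc.keys.card) * B.s ≤ w) :
    Ends (optimize B.κ B.D queue p anc CL CR) m
      (Charged B.κ m (CL.size B.κ + CR.size B.κ) ((w + 1) * (B.step + T))) := by
  induction w generalizing queue anc CL CR m with
  | zero =>
    cases queue with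
    | nil =>
      rw [optimize.eq_def]
      simp only [ends_bind, ends_tick, ends_compose, Charged, Circuit.size, Bounds.step]
      omega
    | cons q rest =>
      have := q.stmt.one_le_symbols
      simp only [List.map_cons, List.sum_cons] at hw
      omega
  | succ w ih =>
    have hE : (w + 1 + 1) * (B.step + T) = (w + 1) * (B.step + T) + (B.step + T) := by ring
    cases queue with
    | nil =>
      rw [optimize.eq_def]
      simp only [ends_bind, ends_tick, ends_compose, Charged, Circuit.size]
      rw [hE]
      simp only [Bounds.step]
      omega
    | cons q rest =>
      have hrest : ∀ q ∈ rest, GoodItem B p M k q := fun q hq => hqueue q (List.mem_cons_of_mem _ hq)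
      obtain ⟨hfits, hwidth, hcalls⟩ := hqueue q List.mem_cons_self
      obtain ⟨cs, S, x, l⟩ := q
      dsimp only at hfits hwidth hcalls
      have hcs : cs.keys.card ≤ B.K := by have := hfits.ctrl; omega
      have hl := hfits.length
      simp only [List.map_cons, List.sum_cons] at hw
      have hS := hfits.symbols
      have hadd : ∀ {q : CStmt}, GoodItem B p M k q →
          ∀ q' ∈ rest ++ [q], GoodItem B p M k q' := fun hq q' hq' => by
        rcases List.mem_append.1 hq' with h | h
        · exact hrest q' h
        · rwa [List.mem_singleton.1 h]
      have hcard := Finset.card_le_card hanc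
      -- every branch ends with a shorter run of the loop, and the rest of its cost is one step
      have key : ∀ {queue' anc' CL' CR' m'}, (∀ q ∈ queue', GoodItem B p M k q) →
          anc'.keys ⊆ B.keys → (∀ key a l, anc'.lookup key = some (a, l) → l.length ≤ B.n) →
          (queue'.map fun q => q.stmt.symbols).sum + (B.keys.card - anc'.keys.card) * B.s ≤ w →
          m'.time ≤ m.time + (B.step + T) →
          CL'.size B.κ + CR'.size B.κ + m'.fresh + m.time ≤
            CL.size B.κ + CR.size B.κ + m.fresh + m'.time →
          Ends (optimize B.κ B.D queue' p anc' CL' CR') m'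
            (Charged B.κ m (CL.size B.κ + CR.size B.κ) ((w + 1 + 1) * (B.step + T))) := by
        intro queue' anc' CL' CR' m' h₁ h₂ h₃ h₄ h₅ h₆
        refine (ih queue' anc' CL' CR' m' h₁ h₂ h₃ h₄).mono fun C m'' h => h.weaken ?_ h₆
        rw [hE]
        omega
      rw [optimize.eq_def]
      cases S with
      | skip | asg => simp [relWidth] at hwidth
      | seq S₁ S₂ =>
        simp only [relWidth] at hwidth
        simp only [Stmt.calls, List.forall_mem_append] at hcalls
        simp only [Stmt.symbols] at hw hS
        have := S₁.one_le_symbols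
        have := S₂.one_le_symbols
        have f₁ : Fits B M k S₁ x l cs := hfits.sub (by simp only [Stmt.symbols]; omega)
        have f₂ : Fits B M k S₂ x l cs := hfits.sub (by simp only [Stmt.symbols]; omega)
        have := Bounds.widthTime_le f₁.symbols
        simp only [ends_bind, ends_tick]
        split_ifs with h
        · simp only [ends_bind]
          refine (hcompr S₂ x l cs (lowCall_of_relWidth_eq_zero (by omega) hcalls.2) f₂ _).mono
            fun C m' ⟨ht, hc⟩ => ?_
          simp only [ends_compose]
          refine key (hadd ⟨f₁, h, hcalls.1⟩) hanc hlen ?_ ?_ ?_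
          · simp; omega
          · simp only [Bounds.step] at *; omega
          · simp only [Circuit.size] at *; omega
        · simp only [ends_bind]
          refine (hcompr S₁ x l cs (lowCall_of_relWidth_eq_zero (by omega) hcalls.1) f₁ _).mono
            fun C m' ⟨ht, hc⟩ => ?_
          simp only [ends_compose]
          refine key (hadd ⟨f₂, by dsimp only; omega, hcalls.2⟩) hanc hlen ?_ ?_ ?_
          · simp; omega
          · simp only [Bounds.step] at *; omega
          · simp only [Circuit.size] at *; omega
      | ite b St Sf =>
        simp only [relWidth] at hwidth
        simp only [Stmt.calls, List.forall_mem_append] at hcalls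
        simp only [Stmt.symbols] at hw hS
        have htime := (BExp.time_le (x := x) hl b).trans
          (Bounds.mul_le_step (B := B) (k := b.symbols) (by omega))
        obtain ⟨S, hSel, hSs, hSw, hSc⟩ : ∃ S, (bif b.eval x l then St else Sf) = S ∧
            S.symbols < b.symbols + St.symbols + Sf.symbols + 1 ∧ relWidth B.D p S ≤ 1 ∧
            ∀ c ∈ S.calls, GoodCall B p c := by
          cases b.eval x l
          · exact ⟨Sf, rfl, by omega, by omega, hcalls.2⟩
          · exact ⟨St, rfl, by omega, by omega, hcalls.1⟩
        have f : Fits B M k S x l cs := hfits.sub (by simp only [Stmt.symbols]; omega)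
        have := Bounds.widthTime_le f.symbols
        simp only [ends_bind, ends_tick, hSel]
        split_ifs with h
        · refine key (hadd ⟨f, h, hSc⟩) hanc hlen ?_ ?_ ?_
          · simp; omega
          · simp only [Bounds.step] at *; omega
          · dsimp only; omega
        · simp only [ends_bind]
          refine (hcompr S x l cs (lowCall_of_relWidth_eq_zero (by omega) hSc) f _).mono
            fun C m' ⟨ht, hc⟩ => ?_
          simp only [ends_compose]
          refine key hrest hanc hlen ?_ ?_ ?_
          · omega
          · simp only [Bounds.step] at *; omega
          · simp only [Circuit.size] at *; omega
      | qcase s i S₀ S₁ =>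
        simp only [relWidth] at hwidth
        simp only [Stmt.calls, List.forall_mem_append] at hcalls
        simp only [Stmt.symbols] at hw hS
        have htime := (qubitTime_le (x := x) hl s i).trans
          (Bounds.mul_le_step (B := B) (by omega))
        have f₀ := hfits.insert (S' := S₀) (by simp only [Stmt.symbols]; omega)
          (qubitEval x l s i) false
        have f₁ := hfits.insert (S' := S₁) (by simp only [Stmt.symbols]; omega)
          (qubitEval x l s i) true
        have := Bounds.widthTime_le f₀.symbols
        have := Bounds.widthTime_le f₁.symbols
        simp only [ends_bind, ends_tick, ends_setCtrl]
        split_ifs with h h₁ h₀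
        · refine key (fun q hq => ?_) hanc hlen ?_ ?_ ?_
          · simp only [List.mem_append, List.mem_cons, List.not_mem_nil, or_false] at hq
            rcases hq with hq | rfl | rfl
            · exact hrest q hq
            · exact ⟨f₀, h.1, hcalls.1⟩
            · exact ⟨f₁, h.2, hcalls.2⟩
          · simp; omega
          · simp only [Bounds.step] at *; omega
          · dsimp only; omega
        · simp only [ends_bind]
          refine (hcompr S₁ x l _ (lowCall_of_relWidth_eq_zero h₁ hcalls.2) f₁ _).mono
            fun C m' ⟨ht, hc⟩ => ?_
          simp only [ends_compose]
          refine key (hadd ⟨f₀, by dsimp only; omega, hcalls.1⟩) hanc hlen ?_ ?_ ?_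
          · simp; omega
          · simp only [Bounds.step] at *; omega
          · simp only [Circuit.size] at *; omega
        · simp only [ends_bind]
          refine (hcompr S₀ x l _ (lowCall_of_relWidth_eq_zero h₀ hcalls.1) f₀ _).mono
            fun C m' ⟨ht, hc⟩ => ?_
          simp only [ends_compose]
          refine key (hadd ⟨f₁, by dsimp only; omega, hcalls.2⟩) hanc hlen ?_ ?_ ?_
          · simp; omega
          · simp only [Bounds.step] at *; omega
          · simp only [Circuit.size] at *; omega
        · omega
      | call p' i s =>
        have heq : Equivalent B.D p p' := by
          simpa [relWidth] using hwidth
        obtain ⟨hdecl, hlits, hshr, -⟩ := hcalls (p', i, s) (by simp [Stmt.calls])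
        dsimp only at hdecl hlits hshr
        have htime := (callTime_le (x := x) hl p' i s).trans
          (Bounds.mul_le_step (B := B) (by omega))
        have hsym := (Stmt.call p' i s).one_le_symbols
        have hlen' := (length_sexp_eval x l s).trans hl
        simp only [ends_bind, ends_tick]
        split_ifs with hnil
        · refine key hrest hanc hlen ?_ ?_ ?_
          · omega
          · simp only [Bounds.step] at *; omega
          · dsimp only; omega
        have hpot := (potential_shrinking_call_le hl hlits (hshr heq) hnil).trans hfits.potential
        have hmem := mem_keys_of_potential hdecl (hpot.trans hM) hlen'
        simp only [ends_bind, ends_tick]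
        cases hlook : anc.lookup (p', argEval x l i, (s.eval x l).length) with
        | some v =>
          obtain ⟨a, l''⟩ := v
          have hl'' := hlen _ _ _ hlook
          simp only [ends_bind, ends_tick, ends_newAncilla, ends_setCtrl, ends_emit, ends_compose]
          have hctrl : ((∅ : Ctrl).insert m.fresh true).keys.card ≤ B.K := by
            have := card_keys_insert_le (∅ : Ctrl) m.fresh true
            simp only [Finmap.keys_empty, Finset.card_empty] at this
            omega
          have g₁ := Bounds.cnot_size_le (a := m.fresh) hcs
          have g₂ := Bounds.cnot_size_le (a := a) hctrl
          have g₃ := Bounds.swap_size_le (l₂ := l'') hctrl hlen'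
          have g₄ := Bounds.swap_size_le (l₂ := s.eval x l) hctrl hl''
          refine key hrest hanc hlen ?_ ?_ ?_
          · omega
          · simp only [Finmap.keys_empty, Finset.card_empty, Bounds.step] at *; omega
          · simp only [Finmap.keys_empty, Finset.card_empty, Circuit.size]; omega
        | none =>
          simp only [ends_bind, ends_tick, ends_newAncilla, ends_setCtrl, ends_emit, ends_compose,
            ends_findDecl]
          obtain ⟨d, hd, rfl, hfind⟩ := find_decl hdecl
          obtain ⟨hds, hdw, hdc⟩ := hbody d hd heq
          rw [hfind]
          simp only [ends_bind, ends_tick]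
          have hctrl := card_keys_insert_le (∅ : Ctrl) m.fresh true
          simp only [Finmap.keys_empty, Finset.card_empty] at hctrl
          have g₁ := Bounds.cnot_size_le (a := m.fresh) hcs
          have hnew : (d.name, argEval x l i, (s.eval x l).length) ∉ anc.keys := by
            rw [Finmap.mem_keys]
            exact Finmap.lookup_eq_none.1 hlook
          have hkeys := keys_insert anc (d.name, argEval x l i, (s.eval x l).length)
            (m.fresh, s.eval x l)
          have hsub := Finset.insert_subset hmem hanc
          have hcard' := Finset.card_le_card hsub
          rw [Finset.card_insert_of_notMem hnew] at hcard'
          refine key (hadd ⟨⟨hlen', hpot, ?_, hds⟩, hdw, hdc⟩) ?_ ?_ ?_ ?_ ?_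
          · dsimp only; omega
          · rw [hkeys]; exact hsub
          · intro key a l' h
            by_cases hk : key = (d.name, argEval x l i, (s.eval x l).length)
            · subst hk
              rw [Finmap.lookup_insert] at h
              cases h
              exact hlen'
            · rw [Finmap.lookup_insert_of_ne _ hk] at h
              exact hlen _ _ _ h
          · rw [hkeys, Finset.card_insert_of_notMem hnew]
            -- the new key pays for the body that is added to the queue
            have hpay : (B.keys.card - anc.keys.card) * B.s =
                (B.keys.card - (anc.keys.card + 1)) * B.s + B.s := by
              rw [← Nat.succ_mul]
              congr 1
              omega
            simp only [List.map_append, List.sum_append, List.map_cons, List.map_nil,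
              List.sum_cons, List.sum_nil]
            omega
          · simp only [Finmap.keys_empty, Finset.card_empty, Bounds.step] at *; omega
          · simp only [Finmap.keys_empty, Finset.card_empty, Circuit.size]; omega

/-! ### The compilation of statements -/

/-- A bound for the cost of the compilation of a call to a procedure of rank less than `h`: the body
has at most `B.s` symbols, and the loop of the optimization takes at most `B.s` steps for each key
of the dictionary. -/
noncomputable def callBudget (B : Bounds) : ℕ → ℕ
  | 0 => B.step
  | h + 1 =>
      B.step + (B.s + B.keys.card * B.s + 1) * (B.step + 2 * B.s * callBudget B h)

theorem step_le_callBudget (B : Bounds) : ∀ h, B.step ≤ callBudget B h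
  | 0 => le_rfl
  | _ + 1 => Nat.le_add_right _ _

theorem callBudget_succ_ge (B : Bounds) (h : ℕ) :
    B.step + (B.step + 2 * B.s * callBudget B h) ≤ callBudget B (h + 1) := by
  rw [callBudget]
  exact Nat.add_le_add_left (Nat.le_mul_of_pos_left _ (Nat.succ_pos _)) _

/-- The compilation of a statement is cheap if the compilation of its calls is. The cost of the
composition of two circuits, which has no symbol of its own, is paid by the subtracted term. -/
theorem ends_compr_of_calls {B : Bounds} {h M k T : ℕ} (hk : k ≤ B.K) (hT : B.step ≤ T)
    (hcall : ∀ p i s x l cs, LowCall B h (p, i, s) → Fits B M k (.call p i s) x l cs →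
      ∀ m, Ends (compr B.κ B.D (.call p i s) x l cs) m (Charged B.κ m 0 T))
    (S : Stmt) (x : ℤ) (l : List ℕ) (cs : Ctrl) (hS : ∀ c ∈ S.calls, LowCall B h c)
    (hfits : Fits B M k S x l cs) (m : Machine) :
    Ends (compr B.κ B.D S x l cs) m (Charged B.κ m 0 (2 * S.symbols * T - T)) := by
  have hl := hfits.length
  have hcs : cs.keys.card ≤ B.K := by have := hfits.ctrl; omega
  have hsym := hfits.symbols
  have hmul : ∀ {a b : ℕ}, a ≤ b → a * T ≤ b * T := fun h => Nat.mul_le_mul_right T h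
  induction S generalizing cs m with
  | skip =>
    rw [compr.eq_def]
    simp only [ends_bind, ends_tick, ends_pure, Charged, Circuit.size, Stmt.symbols, Bounds.step] at *
    omega
  | asg s i U =>
    rw [compr.eq_def]
    simp only [Stmt.symbols] at hsym
    have h₁ := hmul (show 2 ≤ 2 * (Stmt.asg s i U).symbols by simp only [Stmt.symbols]; omega)
    have h₂ := qubitTime_le (x := x) hl s i
    have h₃ := Op.time_le (x := x) hl U
    have h₄ := Bounds.mul_le_step (B := B) (k := s.symbols + i.symbols + 1 + U.symbols) (by omega)
    rw [Nat.add_mul] at h₄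
    have h₅ := Bounds.unary_size_le (M := U.eval x l) (a := qubitEval x l s i) hcs
    simp only [ends_bind, ends_tick, ends_emit, Charged, Circuit.size, Bounds.step] at *
    omega
  | seq S₁ S₂ ih₁ ih₂ =>
    rw [compr.eq_def]
    simp only [Stmt.calls, List.forall_mem_append] at hS
    have hs : (Stmt.seq S₁ S₂).symbols = S₁.symbols + S₂.symbols := rfl
    have p₁ := S₁.one_le_symbols
    have p₂ := S₂.one_le_symbols
    have f₁ := hfits.sub (S' := S₁) (by omega)
    have f₂ := hfits.sub (S' := S₂) (by omega)
    have h₁ := hmul (show 2 ≤ 2 * S₁.symbols by omega)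
    have h₂ := hmul (show 2 ≤ 2 * S₂.symbols by omega)
    have h₃ : 2 * (S₁.symbols + S₂.symbols) * T = 2 * S₁.symbols * T + 2 * S₂.symbols * T := by ring
    have hT' : 2 ≤ T := by simp only [Bounds.step] at hT; omega
    simp only [ends_bind, ends_tick]
    refine (ih₁ cs hS.1 f₁ _ hcs f₁.symbols).mono fun C₁ m₁ ⟨t₁, c₁⟩ => ?_
    refine (ih₂ cs hS.2 f₂ _ hcs f₂.symbols).mono fun C₂ m₂ ⟨t₂, c₂⟩ => ?_
    rw [hs, h₃]
    simp only [ends_compose, Charged, Circuit.size] at *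
    omega
  | ite b St Sf iht ihf =>
    rw [compr.eq_def]
    simp only [Stmt.calls, List.forall_mem_append] at hS
    simp only [Stmt.symbols] at hsym
    have hs : (Stmt.ite b St Sf).symbols = b.symbols + St.symbols + Sf.symbols + 1 := rfl
    have ft := hfits.sub (S' := St) (by omega)
    have ff := hfits.sub (S' := Sf) (by omega)
    have htime := (BExp.time_le (x := x) hl b).trans
      (Bounds.mul_le_step (B := B) (k := b.symbols) (by omega))
    have pt := St.one_le_symbols
    have pf := Sf.one_le_symbols
    have h₁ := hmul (show 2 ≤ 2 * St.symbols by omega)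
    have h₂ := hmul (show 2 ≤ 2 * Sf.symbols by omega)
    have h₃ : 2 * (b.symbols + St.symbols + Sf.symbols + 1) * T =
        2 * b.symbols * T + 2 * St.symbols * T + 2 * Sf.symbols * T + 2 * T := by ring
    have hT' : b.time x l + 1 ≤ T := by simp only [Bounds.step] at hT; omega
    simp only [ends_bind, ends_tick]
    cases b.eval x l
    · refine (ihf cs hS.2 ff _ hcs ff.symbols).mono fun C m' hC => hC.weaken ?_ ?_
      · rw [hs, h₃]; dsimp only; omega
      · dsimp only; omega
    · refine (iht cs hS.1 ft _ hcs ft.symbols).mono fun C m' hC => hC.weaken ?_ ?_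
      · rw [hs, h₃]; dsimp only; omega
      · dsimp only; omega
  | qcase s i S₀ S₁ ih₀ ih₁ =>
    rw [compr.eq_def]
    simp only [Stmt.calls, List.forall_mem_append] at hS
    simp only [Stmt.symbols] at hsym
    have hs : (Stmt.qcase s i S₀ S₁).symbols =
      s.symbols + i.symbols + S₀.symbols + S₁.symbols + 1 := rfl
    have f₀ := hfits.insert (S' := S₀) (by omega) (qubitEval x l s i) false
    have f₁ := hfits.insert (S' := S₁) (by omega) (qubitEval x l s i) true
    have htime := (qubitTime_le (x := x) hl s i).trans (Bounds.mul_le_step (B := B) (by omega))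
    have p₀ := S₀.one_le_symbols
    have p₁ := S₁.one_le_symbols
    have h₁ := hmul (show 2 ≤ 2 * S₀.symbols by omega)
    have h₂ := hmul (show 2 ≤ 2 * S₁.symbols by omega)
    have h₃ : 2 * (s.symbols + i.symbols + S₀.symbols + S₁.symbols + 1) * T =
        2 * (s.symbols + i.symbols) * T + 2 * S₀.symbols * T + 2 * S₁.symbols * T + 2 * T := by
      ring
    have hT' : qubitTime x l s i + 2 * cs.keys.card + 4 ≤ T := by
      simp only [Bounds.step] at hT; omega
    simp only [ends_bind, ends_tick, ends_setCtrl]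
    refine (ih₀ _ hS.1 f₀ _ (by have := f₀.ctrl; omega) f₀.symbols).mono fun C₀ m₀ ⟨t₀, c₀⟩ => ?_
    refine (ih₁ _ hS.2 f₁ _ (by have := f₁.ctrl; omega) f₁.symbols).mono fun C₁ m₁ ⟨t₁, c₁⟩ => ?_
    rw [hs, h₃]
    simp only [ends_compose, Charged, Circuit.size] at *
    omega
  | call p i s =>
    refine (hcall p i s x l cs (hS _ (by simp [Stmt.calls])) hfits m).mono
      fun C m' hC => hC.weaken ?_ (by omega)
    have := hmul (show 2 ≤ 2 * (Stmt.call p i s).symbols by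
      have := (Stmt.call p i s).one_le_symbols; omega)
    omega

/-- The conditions on the declarations under which the algorithm is cheap. They hold for `PFOQ`
programs. -/
structure Bounds.Sound (B : Bounds) : Prop where
  nodup : (B.D.map Decl.name).Nodup
  width : ∀ d ∈ B.D, d.width B.D ≤ 1
  symbols : ∀ d ∈ B.D, d.body.symbols ≤ B.s
  calls : ∀ d ∈ B.D, ∀ c ∈ d.body.calls, (∃ e ∈ B.D, e.name = c.1) ∧ argLits c.2.1 ≤ B.c ∧
    (Equivalent B.D d.name c.1 → c.2.2.Shrinking)

theorem Bounds.Sound.goodCall {B : Bounds} (hB : B.Sound) {p : ProcName} {d : Decl} (hd : d ∈ B.D)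
    (h : Equivalent B.D p d.name) : ∀ c ∈ d.body.calls, GoodCall B p c := by
  intro c hc
  obtain ⟨h₁, h₂, h₃⟩ := hB.calls d hd c hc
  refine ⟨h₁, h₂, fun h' => h₃ (h.symm.trans h'), fun h' => ?_⟩
  rw [h.rank_eq]
  exact rank_lt_of_not_equivalent ⟨d, hd, rfl, c, hc, rfl⟩ h₁ fun h'' => h' (h.trans h'')

theorem Bounds.Sound.body {B : Bounds} (hB : B.Sound) {d : Decl} (hd : d ∈ B.D)
    (hw : relWidth B.D d.name d.body ≠ 0) :
    ∀ e ∈ B.D, Equivalent B.D d.name e.name → e.body.symbols ≤ B.s ∧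
      relWidth B.D d.name e.body = 1 ∧ ∀ c ∈ e.body.calls, GoodCall B d.name c := by
  intro e he h
  have h₁ := relWidth_body_ne_zero hB.nodup hd he h hw
  have h₂ : relWidth B.D e.name e.body ≤ 1 := hB.width e he
  rw [← h.relWidth_eq] at h₂
  exact ⟨hB.symbols e he, by omega, hB.goodCall he h⟩

/-- By induction on `h`, statements whose calls are to procedures of rank less than `h` are compiled
in time linear in the budget of one call. Each level may raise the number of controls by `B.s`, and
the potential by `B.n + B.c`. -/
theorem ends_compr {B : Bounds} (hB : B.Sound) (h : ℕ) {M k : ℕ}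
    (hM : M + h * (B.n + B.c) ≤ B.X) (hk : k + h * B.s ≤ B.K) (hks : B.s + 1 ≤ k)
    (S : Stmt) (x : ℤ) (l : List ℕ) (cs : Ctrl) (hS : ∀ c ∈ S.calls, LowCall B h c)
    (hfits : Fits B M k S x l cs) (m : Machine) :
    Ends (compr B.κ B.D S x l cs) m
      (Charged B.κ m 0 (2 * S.symbols * callBudget B h - callBudget B h)) := by
  induction h generalizing M k S x l cs m with
  | zero =>
    refine ends_compr_of_calls (by omega) (step_le_callBudget B 0) ?_ S x l cs hS hfits m
    exact fun p i s x l cs hc => absurd hc.2.2 (Nat.not_lt_zero _)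
  | succ h ih =>
    refine ends_compr_of_calls (by omega) (step_le_callBudget B _) ?_ S x l cs hS hfits m
    clear hfits hS m S x l cs
    rintro p i s x l cs ⟨hdecl, hlits, hrank⟩ hfits m
    dsimp only at hdecl hlits hrank
    rw [Nat.succ_mul] at hM hk
    have hl := hfits.length
    have hsym := hfits.symbols
    have htime := (callTime_le (x := x) hl p i s).trans (Bounds.mul_le_step (B := B) (by omega))
    have hbudget := callBudget_succ_ge B h
    obtain ⟨d, hd, rfl, hfind⟩ := find_decl hdecl
    have hbody : Fits B (M + (B.n + B.c)) (k + B.s) d.body (argEval x l i) (s.eval x l) cs :=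
      ⟨(length_sexp_eval x l s).trans hl,
        (potential_call_le hl hlits).trans (Nat.add_le_add_right hfits.potential _), by
          have := hfits.ctrl
          have := hB.symbols d hd
          omega, hB.symbols d hd⟩
    have hwt := Bounds.widthTime_le hbody.symbols
    have hds := hbody.symbols
    rw [compr.eq_def]
    simp only [ends_bind, ends_tick]
    split_ifs with hnil
    · simp only [ends_pure, Charged, Circuit.size, Bounds.step] at *
      omega
    simp only [ends_bind, ends_tick, ends_findDecl, hfind]
    -- the compilation of a statement that contains no call of rank `h` or more
    have hlow : ∀ S x l cs, (∀ c ∈ S.calls, LowCall B (rank B.D d.name) c) →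
        Fits B (M + (B.n + B.c)) (k + B.s) S x l cs → ∀ m,
        Ends (compr B.κ B.D S x l cs) m (Charged B.κ m 0 (2 * B.s * callBudget B h)) := by
      intro S x l cs hS hf m
      refine (ih (by omega) (by omega) (by omega) S x l cs (fun c hc => ?_) hf m).mono
        fun C m' hC => hC.weaken ?_ (by omega)
      · obtain ⟨h₁, h₂, h₃⟩ := hS c hc
        exact ⟨h₁, h₂, by omega⟩
      · have := Nat.mul_le_mul_right (callBudget B h) (Nat.mul_le_mul_left 2 hf.symbols)
        omega
    have hgood := hB.goodCall hd (Equivalent.refl d.name)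
    split_ifs with hw₀ hw₁
    · refine (hlow d.body _ _ cs (lowCall_of_relWidth_eq_zero hw₀ hgood) hbody _).mono
        fun C m' hC => hC.weaken ?_ ?_
      · simp only [Bounds.step] at *; omega
      · dsimp only; omega
    · refine (ends_optimize (w := B.s + B.keys.card * B.s) (by omega) (by omega) (by omega) hlow
        (hB.body hd hw₀) _ ∅ .id .id _ ?_ ?_ ?_ ?_).mono fun C m' hC => hC.weaken ?_ ?_
      · intro q hq
        rw [List.mem_singleton.1 hq]
        exact ⟨hbody, hw₁, hgood⟩
      · simp
      · intro key a l' h'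
        simp at h'
      · simp only [List.map_cons, List.map_nil, List.sum_cons, List.sum_nil, Finmap.keys_empty,
          Finset.card_empty, Nat.sub_zero]
        omega
      · rw [callBudget]
        simp only [Bounds.step] at *; omega
      · simp only [Circuit.size]; omega
    · exact absurd (hB.width d hd) (by omega)

/-! ### Polynomial growth -/

/-- The function `f` is bounded by a multiple of `(n + 1) ^ e`. -/
def PolyLE (f : ℕ → ℕ) (e : ℕ) : Prop := ∃ C, ∀ n, f n ≤ C * (n + 1) ^ e

namespace PolyLE

variable {f g : ℕ → ℕ} {d e : ℕ}

theorem const (c : ℕ) : PolyLE (fun _ => c) 0 := ⟨c, fun n => by simp⟩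

theorem id : PolyLE (fun n => n) 1 := ⟨1, fun n => by simp⟩

theorem mono (h : PolyLE f d) (hde : d ≤ e) : PolyLE f e := by
  obtain ⟨C, hC⟩ := h
  exact ⟨C, fun n => (hC n).trans
    (Nat.mul_le_mul_left _ (Nat.pow_le_pow_right (Nat.succ_pos n) hde))⟩

theorem of_le (hg : PolyLE g e) (h : ∀ n, f n ≤ g n) :
    PolyLE f e := by
  obtain ⟨C, hC⟩ := hg
  exact ⟨C, fun n => (h n).trans (hC n)⟩

theorem add (hf : PolyLE f e) (hg : PolyLE g e) : PolyLE (fun n => f n + g n) e := by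
  obtain ⟨C, hC⟩ := hf
  obtain ⟨C', hC'⟩ := hg
  exact ⟨C + C', fun n => (Nat.add_le_add (hC n) (hC' n)).trans_eq (Nat.add_mul _ _ _).symm⟩

theorem mul (hf : PolyLE f d) (hg : PolyLE g e) : PolyLE (fun n => f n * g n) (d + e) := by
  obtain ⟨C, hC⟩ := hf
  obtain ⟨C', hC'⟩ := hg
  exact ⟨C * C', fun n => (Nat.mul_le_mul (hC n) (hC' n)).trans_eq (by ring)⟩

theorem constMul (c : ℕ) (hf : PolyLE f e) : PolyLE (fun n => c * f n) e := by
  simpa using (const c).mul hf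

theorem isBigO (hf : PolyLE f e) :
    Asymptotics.IsBigO Filter.atTop (fun n => (f n : ℝ)) (fun n => (n : ℝ) ^ e) := by
  obtain ⟨C, hC⟩ := hf
  refine Asymptotics.IsBigO.of_bound (C * 2 ^ e) ?_
  filter_upwards [Filter.eventually_ge_atTop 1] with n hn
  have h : f n ≤ C * 2 ^ e * n ^ e := by
    refine (hC n).trans ?_
    rw [Nat.mul_assoc, ← Nat.mul_pow]
    exact Nat.mul_le_mul_left _ (Nat.pow_le_pow_left (by omega) e)
  rw [Real.norm_of_nonneg (Nat.cast_nonneg _), Real.norm_of_nonneg (by positivity)]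
  exact_mod_cast h

theorem exists_polynomial (hf : PolyLE f e) : ∃ Q : Polynomial ℕ, ∀ n, f n ≤ Q.eval n := by
  obtain ⟨C, hC⟩ := hf
  refine ⟨Polynomial.C C * (Polynomial.X + 1) ^ e, fun n => ?_⟩
  simpa using hC n

end PolyLE

/-! ### The bounds of a program -/

/-- The sum of the literals in the integer arguments of all calls. -/
def Program.argLits (P : Program) : ℕ :=
  ((P.main.calls ++ P.decls.flatMap fun d => d.body.calls).map fun c => FOQ.argLits c.2.1).sum

theorem Program.argLits_le {P : Program} {c : ProcName × Option IExp × SExp}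
    (hc : c ∈ P.main.calls ∨ ∃ d ∈ P.decls, c ∈ d.body.calls) :
    FOQ.argLits c.2.1 ≤ P.argLits :=
  List.le_sum_of_mem (List.mem_map_of_mem (f := fun c => FOQ.argLits c.2.1)
    (List.mem_append.2 (hc.imp_right List.mem_flatMap.2)))

/-- The bounds for the compilation of `P` on `n` qubits. The main statement starts with no controls
and with the potential `(n + P.argLits) * n`; both may grow at each level of the call graph. -/
def Program.bounds (κ : ℕ) (P : Program) (n : ℕ) : Bounds where
  κ := κ
  D := P.decls
  n := n
  s := P.size
  c := P.argLits
  K := P.size + 1 + P.decls.length * P.size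
  X := (n + P.argLits) * n + P.decls.length * (n + P.argLits)

theorem Program.body_symbols_le {P : Program} {d : Decl} (hd : d ∈ P.decls) :
    d.body.symbols ≤ P.size := by
  have h₁ : d.symbols ≤ (P.decls.map Decl.symbols).sum :=
    List.le_sum_of_mem (List.mem_map_of_mem hd)
  unfold Decl.symbols at h₁
  unfold Program.size declsSymbols Decl.symbols
  omega

theorem four_mul_length_le (D : List Decl) : 4 * D.length ≤ declsSymbols D := by
  induction D with
  | nil => simp
  | cons d D ih =>
    have := d.body.one_le_symbols
    simp only [declsSymbols, List.map_cons, List.sum_cons, List.length_cons, Decl.symbols] at *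
    omega

/-- A statement without calls has a budget of degree `3`, and every level of the call graph adds `3`
to the degree. A declaration has at least four symbols, which leaves room in the exponent. -/
theorem Program.exponent_le (P : Program) : 3 * P.decls.length + 3 ≤ 2 * P.size + 1 := by
  have h₁ := four_mul_length_le P.decls
  have h₂ := P.main.one_le_symbols
  unfold Program.size
  omega

theorem bounds_sound {κ : ℕ} {P : Program} (hP : P ∈ PFOQ) (n : ℕ) : (P.bounds κ n).Sound := by
  obtain ⟨⟨-, -, hnd, -, hcd⟩, ⟨-, hshr⟩, hw⟩ := hP
  refine ⟨hnd, hw, fun d hd => Program.body_symbols_le hd, fun d hd c hc => ⟨?_, ?_, hshr d hd c hc⟩⟩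
  · obtain ⟨e, he, hname, -⟩ := hcd d hd c hc
    exact ⟨e, he, hname⟩
  · exact Program.argLits_le (.inr ⟨d, hd, hc⟩)

theorem card_keys_le (B : Bounds) :
    B.keys.card ≤ B.D.length * ((2 * B.X + 1) * (B.n + 1)) := by
  classical
  unfold Bounds.keys
  rw [Finset.card_product, Finset.card_product, Int.card_Icc, Finset.card_range]
  refine Nat.mul_le_mul ((List.toFinset_card_le _).trans (by simp)) (Nat.mul_le_mul_right _ ?_)
  omega

theorem polyLE_keys (κ : ℕ) (P : Program) : PolyLE (fun n => (P.bounds κ n).keys.card) 3 := by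
  refine PolyLE.of_le ?_ fun n => card_keys_le (P.bounds κ n)
  have hb : ∀ c, PolyLE (fun n => n + c) 1 := fun c => .add .id (.mono (.const c) (by omega))
  change PolyLE (fun n => P.decls.length * ((2 * ((n + P.argLits) * n +
    P.decls.length * (n + P.argLits)) + 1) * (n + 1))) (2 + 1)
  exact .constMul _ (.mul (d := 2) (.add (.constMul 2 (.add (.mul (hb _) .id)
    (.mono (.constMul _ (hb _)) (by omega)))) (.mono (.const 1) (by omega))) (hb 1))

theorem polyLE_step (κ : ℕ) (P : Program) : PolyLE (fun n => (P.bounds κ n).step) 3 := by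
  have hc : ∀ c, PolyLE (fun _ => c) 3 := fun c => .mono (.const c) (by omega)
  have hn : PolyLE (fun n => n) 3 := .mono .id (by omega)
  let g := κ * (P.size + 1 + P.decls.length * P.size + 1) + 1
  change PolyLE (fun n => 30 + 2 * P.size + (P.size + 1) * (n + 1) +
    2 * (declsSymbols P.decls + P.size) ^ 2 + 2 * (P.size + 1 + P.decls.length * P.size) + 5 * n +
    (P.bounds κ n).keys.card + 4 * g + 2 * (g * n) + 2 * P.decls.length) 3
  exact .add (.add (.add (.add (.add (.add (.add (.add (hc _) (.constMul _ (.add hn (hc 1))))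
    (hc _)) (hc _)) (.constMul 5 hn)) (polyLE_keys κ P)) (hc _)) (.constMul 2 (.constMul _ hn)))
    (hc _)

theorem polyLE_callBudget (κ : ℕ) (P : Program) (h : ℕ) :
    PolyLE (fun n => callBudget (P.bounds κ n) h) (3 * h + 3) := by
  induction h with
  | zero => exact polyLE_step κ P
  | succ h ih =>
    have hkeys : PolyLE (fun n => P.size + (P.bounds κ n).keys.card * P.size + 1) 3 :=
      .add (.add (.mono (.const _) (by omega)) (.mul (polyLE_keys κ P) (.const _)))
        (.mono (.const 1) (by omega))
    have hstep := polyLE_step κ P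
    exact .add (.mono hstep (by omega)) (.mono (.mul hkeys
      (.add (.mono hstep (by omega)) (.constMul (2 * P.size) ih))) (by omega))

/-- The compilation terminates, and its cost is the one of the main statement, whose calls are to
procedures of any rank. -/
theorem exists_run {κ : ℕ} {P : Program} (hP : P ∈ PFOQ) (n : ℕ) :
    ∃ r, compile κ P n = some r ∧
      r.time ≤ n + 1 + 2 * P.size * callBudget (P.bounds κ n) P.decls.length ∧
      r.size κ ≤ n + 1 + 2 * P.size * callBudget (P.bounds κ n) P.decls.length := by
  have hcd := hP.1.2.2.2.1
  have hmain : P.main.symbols ≤ P.size := Nat.le_add_left _ _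
  have hcalls : ∀ c ∈ P.main.calls, LowCall (P.bounds κ n) P.decls.length c := by
    intro c hc
    obtain ⟨d, hd, hname, -⟩ := hcd c hc
    exact ⟨⟨d, hd, hname⟩, Program.argLits_le (.inl hc), rank_lt_length ⟨d, hd, hname⟩⟩
  have hfits : Fits (P.bounds κ n) ((n + (P.bounds κ n).c) * n) (P.size + 1) P.main 0
      (initPointers n) ∅ := by
    refine ⟨by simp [initPointers, Program.bounds], ?_, ?_, hmain⟩
    · simp [potential, initPointers, Program.bounds]
    · simp only [Finmap.keys_empty, Finset.card_empty]; omega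
  obtain ⟨C, m, hrun, htime, hsize⟩ := ends_compr (bounds_sound hP n) P.decls.length le_rfl le_rfl
    le_rfl P.main 0 (initPointers n) ∅ hcalls hfits ⟨n + 1, n⟩
  have hmul := Nat.mul_le_mul_right (callBudget (P.bounds κ n) P.decls.length)
    (Nat.mul_le_mul_left 2 hmain)
  refine ⟨⟨C, m.fresh - 1, m.time⟩, ?_, ?_, ?_⟩
  · change Option.map _ (compr (P.bounds κ n).κ (P.bounds κ n).D P.main 0 (initPointers n) ∅
      ⟨n + 1, n⟩) = _
    rw [hrun]
    rfl
  · dsimp only at *; omega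
  · simp only [Run.size]
    change C.size κ + _ + _ ≤ _ at hsize
    dsimp only at *
    omega

end FOQ

theorem theorem8 (κ : ℕ) (P : FOQ.Program) (hP : P ∈ FOQ.PFOQ) :
    ∃ run : ℕ → FOQ.Run,
      (∀ n : ℕ, FOQ.compile κ P n = some (run n)) ∧
      Asymptotics.IsBigO Filter.atTop (fun n : ℕ => ((run n).time : ℝ))
        (fun n : ℕ => (n : ℝ) ^ (2 * P.size + 1)) ∧
      ∃ Q : Polynomial ℕ, ∀ n : ℕ, (run n).size κ ≤ Q.eval n := by
  choose run hrun htime hsize using FOQ.exists_run (κ := κ) hP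
  have hpoly : FOQ.PolyLE (fun n => n + 1 + 2 * P.size *
      FOQ.callBudget (P.bounds κ n) P.decls.length) (2 * P.size + 1) :=
    .mono (.add (.mono (.add .id (.mono (.const 1) (by omega))) (by omega))
      (.constMul _ (FOQ.polyLE_callBudget κ P P.decls.length))) P.exponent_le
  obtain ⟨Q, hQ⟩ := hpoly.exists_polynomial
  exact ⟨run, hrun, (hpoly.of_le htime).isBigO, Q, fun n => (hsize n).trans (hQ n)⟩
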